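/- Let $\Bbbk$ be an infinite field, $V$ a finite-dimensional vector space over $\Bbbk$, and $\mathbf c=(c_1,\dots,c_m)$ a tuple of nonnegative integers with $m\ge 1$ and $c_m\ge 2$. For a tuple $\mathbf b$ of nonnegative integers, a $\mathbf b$-arrangement in $V$ is a list of vector subspaces $(Y_i)$ of $V$ with $\operatorname{codim}Y_i=b_i$ for all $i$; the set $\mathrm{Gr}(V,\mathbf b)$ of all of these is a product of Grassmannians and carries the Zariski topology (of $\Bbbk$-points). Let $n=c_1+\cdots+c_m$. Identify the tuples $\mathbf b$ with $0\le b_i\le c_i$ with subsets of $[n]=\{1,\dots,n\}$ by dividing $[n]$ into consecutive blocks of sizes $c_1,\dots,c_m$ and sending $\mathbf b$ to the set consisting of the first $b_i$ elements of the $i$-th block for each $i$; let $\mathcal D_{\mathbf c}\subseteq 2^{[n]}$ be the distributive lattice of the sets obtained. For a $\mathbf c$-arrangement $\mathcal X=(X_1,\dots,X_m)$ define $\rho_{\mathcal X}:\mathcal D_{\mathbf c}\to\mathbb N$ by $$\rho_{\mathcal X}(\mathbf b)=\max\{\operatorname{codim}(Y_1\cap\cdots\cap Y_m) : \mathcal Y\in\mathrm{Gr}(V,\mathbf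 b),\ Y_i\supseteq X_i \text{ for all } i\}.$$ A U-matroid $(E,\mathcal D,\rho)$ consists of a finite set $E$, a family $\mathcal D\subseteq 2^E$ that contains $\emptyset$ and $E$, is closed under union and intersection, and is accessible (every nonempty $A\in\mathcal D$ has an element $x$ with $A\setminus\{x\}\in\mathcal D$), and a monotone submodular function $\rho:\mathcal D\to\mathbb N$ with $\rho(\emptyset)=0$ and with $\rho(A\cup\{e\})\le\rho(A)+1$ whenever $A,A\cup\{e\}\in\mathcal D$. If $a\in E$ and $\{a\}\notin\mathcal D$, its generous atom extension by $a$ is the function $\rho_a$ on $\mathcal D[a]=\mathcal D\cup\{S\cup\{a\}:S\in\mathcal D\}$ given by $$\rho_a(S)=\begin{cases}\rho(S)&\text{if }S\in\mathcal D,\\ \rho(S\setminus\{a\})&\text{if }S\notin\mathcal D\text{ and }\rho(S\setminus\{a\})=\rho(\sup_{\mathcal D}S),\\ \rho(S\setminus\{a\})+1&\text{if }S\notin\mathcal D\text{ and }\rho(S\setminus\{a\})<\rho(\sup_{\mathcal D}S),\end{cases}$$ where $\sup_{\mathcal D}S=\bigcap\{B\in\mathcal D: B\supseteq S\}$. Let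 $\mathcal X=(X_1,\dots,X_m)$ be a $\mathbf c$-arrangement in $V$ and let $\mathbf c'=(c_1,\dots,c_{m-1},c_m-1,1)$. Let $Z\subseteq\mathrm{Gr}(V,\mathbf c')$ be the set of all $\mathbf c'$-arrangements of the form $\mathcal X'=(X_1,\dots,X_{m-1},X'_m,H)$ with $X'_m\cap H=X_m$ (so $\operatorname{codim}X'_m=c_m-1$ and $\operatorname{codim}H=1$). **Theorem.** $([n],\mathcal D_{\mathbf c},\rho_{\mathcal X})$ is a U-matroid, $\{n\}\notin\mathcal D_{\mathbf c}$, and $\mathcal D_{\mathbf c'}=\mathcal D_{\mathbf c}[n]$. The set $Z$ is nonempty, and for generic $\mathcal X'\in Z$, that is, for all $\mathcal X'$ in some dense, relatively Zariski-open subset of $Z$, the function $\rho_{\mathcal X'}:\mathcal D_{\mathbf c'}\to\mathbb N$ is the generous atom extension of $\rho_{\mathcal X}$ by the atom $n$. -/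

import Mathlib

namespace UMat

section Combinatorics

variable {α : Type*}

/-- A U-matroid `(E, D, ρ)`: `E` is a finite ground set, `D ⊆ 2^E` is an accessible distributive
lattice of subsets of `E`, and `ρ : D → ℕ` is calibrated, monotone, submodular and has unit
increase. The function `ρ` is written as a total function; only its values on `D` matter. -/
structure IsUMatroid (E : Set α) (D : Set (Set α)) (ρ : Set α → ℕ) : Prop where
  finite_ground : E.Finite
  subset_ground : ∀ A ∈ D, A ⊆ E
  empty_mem : ∅ ∈ D
  ground_mem : E ∈ D
  union_mem : ∀ A ∈ D, ∀ B ∈ D, A ∪ B ∈ D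
  inter_mem : ∀ A ∈ D, ∀ B ∈ D, A ∩ B ∈ D
  accessible : ∀ A ∈ D, A.Nonempty → ∃ x ∈ A, A \ {x} ∈ D
  calibration : ρ ∅ = 0
  monotone : ∀ A ∈ D, ∀ B ∈ D, A ⊆ B → ρ A ≤ ρ B
  submodular : ∀ A ∈ D, ∀ B ∈ D, ρ (A ∪ B) + ρ (A ∩ B) ≤ ρ A + ρ B
  unit_increase : ∀ A ∈ D, ∀ e, insert e A ∈ D → ρ (insert e A) ≤ ρ A + 1

/-- The smallest member of the lattice `D` that contains `A`. -/
def latticeSup (D : Set (Set α)) (A : Set α) : Set α :=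
  ⋂₀ {B | B ∈ D ∧ A ⊆ B}

/-- The lattice `D[a]`, consisting of the sets `S` and `S ∪ {a}` with `S ∈ D`. -/
def adjoinAtom (D : Set (Set α)) (a : α) : Set (Set α) :=
  D ∪ {T | ∃ S ∈ D, T = S ∪ {a}}

open Classical in
/-- The formula for the generous atom extension `ρ_a : D[a] → ℕ`. (In the last case one has
`ρ (S - a) < ρ (latticeSup D S)`, since `ρ` is monotone on `D`.) -/
noncomputable def generousRank (D : Set (Set α)) (ρ : Set α → ℕ) (a : α) (S : Set α) : ℕ :=
  if S ∈ D then ρ S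
  else if ρ (S \ {a}) = ρ (latticeSup D S) then ρ (S \ {a})
  else ρ (S \ {a}) + 1

/-- `(E, D', ρ')` is the generous atom extension of the U-matroid `(E, D, ρ)` by the
element `a ∈ E`, which is not yet an atom of `D`. -/
structure IsGenerousAtomExtension (E : Set α) (D : Set (Set α)) (ρ : Set α → ℕ) (a : α)
    (D' : Set (Set α)) (ρ' : Set α → ℕ) : Prop where
  isUMatroid : IsUMatroid E D ρ
  mem_ground : a ∈ E
  not_atom : {a} ∉ D
  lattice_eq : D' = adjoinAtom D a
  rank_eq : ∀ S ∈ D', ρ' S = generousRank D ρ a S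

end Combinatorics

section Chains

variable {m : ℕ}

/-- The number `c₁ + ⋯ + cᵢ₋₁`. The ground set `{1, …, ∑ c}` is divided into consecutive blocks
of sizes `c₁, …, cₘ`, and the `i`-th block begins just after this number. -/
def blockStart (c : Fin m → ℕ) (i : Fin m) : ℕ := ∑ j ∈ Finset.univ.filter (· < i), c j

/-- The `i`-th block. -/
def block (c : Fin m → ℕ) (i : Fin m) : Set ℕ :=
  Set.Ioc (blockStart c i) (blockStart c i + c i)

/-- The set that consists of the first `bᵢ` elements of the `i`-th block, for every `i`. -/
def chainIdeal (c b : Fin m → ℕ) : Set ℕ :=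
  {e | ∃ i, e ∈ Set.Ioc (blockStart c i) (blockStart c i + b i)}

/-- The product of chains `[0, c₁] × ⋯ × [0, cₘ]`, as a lattice of subsets of
`{1, …, c₁ + ⋯ + cₘ}`. -/
def chainLattice (c : Fin m → ℕ) : Set (Set ℕ) :=
  {S | ∃ b : Fin m → ℕ, (∀ i, b i ≤ c i) ∧ S = chainIdeal c b}

/-- The tuple of numbers `bᵢ` of elements of `S` in the `i`-th block; on `chainLattice c` this is
the inverse of `b ↦ chainIdeal c b`. -/
noncomputable def chainHeights (c : Fin m → ℕ) (S : Set ℕ) (i : Fin m) : ℕ :=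
  (S ∩ block c i).ncard

/-- From `(c₁, …, cₘ₊₁)` to `(c₁, …, cₘ, cₘ₊₁ - 1, 1)`. -/
def splitCodim (c : Fin (m + 1) → ℕ) : Fin (m + 2) → ℕ :=
  Fin.snoc (α := fun _ => ℕ)
    (Function.update c (Fin.last m) (c (Fin.last m) - 1)) 1

end Chains

section Zariski

/-- The algebra of polynomial functions on the vector space `W`: it is generated
by the linear functionals. -/
def polyFun (k W : Type*) [Field k] [AddCommGroup W] [Module k W] : Subalgebra k (W → k) :=
  Algebra.adjoin k {f | ∃ φ : Module.Dual k W, f = fun w => φ w}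

/-- The Zariski topology on (the `k`-points of) the vector space `W`. -/
abbrev zariski (k W : Type*) [Field k] [AddCommGroup W] [Module k W] : TopologicalSpace W :=
  TopologicalSpace.generateFrom {U | ∃ f ∈ polyFun k W, U = {w | f w ≠ 0}}

/-- A property `P` holds for a generic point of `Z`: `Z` is not empty, and `P` holds on a dense
relatively open subset of `Z`. -/
def HoldsGenerically {T : Type*} [TopologicalSpace T] (Z : Set T) (P : T → Prop) : Prop :=
  Z.Nonempty ∧ ∃ U : Set T, IsOpen U ∧ Z ⊆ closure (U ∩ Z) ∧ ∀ x ∈ U ∩ Z, P x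

end Zariski

section Arrangements

variable (k : Type*) [Field k] (V : Type*) [AddCommGroup V] [Module k V] {m : ℕ}

/-- `Gr k V c` is the set of all `c`-arrangements in `V`, that is, lists of subspaces
`(X₁, …, Xₘ)` with `codim Xᵢ = cᵢ`; it is a product of Grassmannians. -/
structure Gr (c : Fin m → ℕ) where
  /-- The subspaces of the arrangement. -/
  space : Fin m → Submodule k V
  codim_eq : ∀ i, Module.finrank k (V ⧸ space i) = c i

/-- Lists of linearly independent systems of `cᵢ` linear equations on `V`. -/
def Equations (c : Fin m → ℕ) : Type _ :=
  {Φ : (i : Fin m) → Fin (c i) → Module.Dual k V // ∀ i, LinearIndependent k (Φ i)}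

/-- The equations are given by their coefficients, so they carry a Zariski topology. -/
instance (c : Fin m → ℕ) : TopologicalSpace (Equations k V c) :=
  (zariski k ((i : Fin m) → Fin (c i) → Module.Dual k V)).induced Subtype.val

variable {k V}

/-- The arrangement of the solution spaces of the given systems of equations. -/
def Equations.solve [FiniteDimensional k V] {c : Fin m → ℕ} (Φ : Equations k V c) : Gr k V c where
  space i := (Submodule.span k (Set.range (Φ.1 i))).dualCoannihilator
  codim_eq i := by
    have h1 := Subspace.finrank_add_finrank_dualCoannihilator_eq
      (Submodule.span k (Set.range (Φ.1 i)))
    have h2 := Submodule.finrank_quotient_add_finrank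
      (Submodule.span k (Set.range (Φ.1 i))).dualCoannihilator
    have h3 := finrank_span_eq_card (Φ.2 i)
    rw [Fintype.card_fin] at h3
    omega

/-- The Zariski topology on the product of Grassmannians: the quotient topology, when an
arrangement is described by linear equations for its members. -/
instance [FiniteDimensional k V] (c : Fin m → ℕ) : TopologicalSpace (Gr k V c) :=
  TopologicalSpace.coinduced Equations.solve inferInstance

/-- `rhoTuple X b = max {codim (Y₁ ∩ ⋯ ∩ Yₘ) | Yᵢ ⊇ Xᵢ and codim Yᵢ = bᵢ for all i}`. -/
noncomputable def rhoTuple {c : Fin m → ℕ} (X : Gr k V c) (b : Fin m → ℕ) : ℕ :=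
  sSup {r | ∃ Y : Gr k V b, (∀ i, X.space i ≤ Y.space i) ∧
    r = Module.finrank k (V ⧸ (⨅ i, Y.space i))}

/-- The rank function of the arrangement `X` on the product of chains, where a member of
`chainLattice c` is identified with the corresponding tuple `b ≤ c`. -/
noncomputable def rho {c : Fin m → ℕ} (X : Gr k V c) (S : Set ℕ) : ℕ :=
  rhoTuple X (chainHeights c S)

/-- All arrangements `(X₁, …, Xₘ, X', H)` obtained from `X = (X₁, …, Xₘ₊₁)` through the
replacement of the last space by a pair `(X', H)` with `codim X' = cₘ₊₁ - 1`, `codim H = 1` and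
`X' ∩ H = Xₘ₊₁`. -/
def splittings {c : Fin (m + 1) → ℕ} (X : Gr k V c) : Set (Gr k V (splitCodim c)) :=
  {X' | (∀ i : Fin m, X'.space i.castSucc.castSucc = X.space i.castSucc) ∧
    X'.space (Fin.last m).castSucc ⊓ X'.space (Fin.last (m + 1)) = X.space (Fin.last m)}

end Arrangements

end UMat

namespace UMat

/-! ### Products of chains as lattices of sets -/

section Chains

variable {m : ℕ}

/-! Pass to the dual space: with `A i` the annihilator of `X i`, of dimension `c i`, the number ρ(b)
is the largest dimension of a sum of subspaces `B i ≤ A i` with `dim B i = b i`. Over an infinite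
field, finitely many nonempty Zariski-open conditions on a linear space of vector tuples hold at a
common point. So there are vectors `v i p ∈ A i`, for `p < c i`, such that every choice `T i` of
some of them spans a space of dimension ρ(|T 1|, …, |T m|) (`exists_generic`).

Thus ρ is read off from ranks of vectors. Submodularity is the dimension formula, and unit increase
holds because a step adds one vector. Since the rank depends only on cardinalities, the vectors of
one block are interchangeable: if one more vector from block `i` does not raise the rank, then all
of block `i` lies in the span already (`rhoTuple_update_eq`).

For a splitting, the annihilators of `X'` and `H` add up to `A m`, so ρ' is at most ρ at the tuple
that merges the last two entries (`rhoTuple_le_of_mem_splittings`). Giving the last generic vector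
of block `m` to `H` and the others to `X'` attains all these bounds at once
(`exists_generic_splitting`). Equality is an open condition because ρ' is lower semicontinuous
(`isOpen_le_rhoTuple`), and the formula for the generous extension follows from equality by the
interchangeability above.

For density, the equations of splittings lie in a fixed linear space, where independence and
spanning `A m` are open conditions. The line from any given splitting to the generic one therefore
has a point that satisfies everything required. -/

theorem blockStart_add_le (c : Fin m → ℕ) {i j : Fin m} (h : i < j) :
    blockStart c i + c i ≤ blockStart c j := by
  unfold blockStart
  rw [add_comm, ← Finset.sum_insert (s := Finset.univ.filter (· < i)) (by simp)]
  refine Finset.sum_le_sum_of_subset fun x hx => ?_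
  simp only [Finset.mem_insert, Finset.mem_filter, Finset.mem_univ, true_and] at hx ⊢
  rcases hx with rfl | hx
  · exact h
  · exact hx.trans h

theorem eq_of_mem_block {c : Fin m → ℕ} {i j : Fin m} {e : ℕ} (hi : e ∈ block c i)
    (hj : e ∈ block c j) : i = j := by
  simp only [block, Set.mem_Ioc] at hi hj
  rcases lt_trichotomy i j with h | h | h
  · have := blockStart_add_le c h
    omega
  · exact h
  · have := blockStart_add_le c h
    omega

theorem blockStart_castSucc (c : Fin (m + 1) → ℕ) (i : Fin m) :
    blockStart c i.castSucc = blockStart (fun j => c j.castSucc) i := by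
  have : ¬ (Fin.last m < i.castSucc) := not_lt.2 (Fin.le_last _)
  simp [blockStart, Finset.sum_filter, Fin.sum_univ_castSucc, this]

theorem blockStart_last (c : Fin (m + 1) → ℕ) :
    blockStart c (Fin.last m) = ∑ j : Fin m, c j.castSucc := by
  simp [blockStart, Finset.sum_filter, Fin.sum_univ_castSucc, Fin.castSucc_lt_last]

theorem blockStart_last_add (c : Fin (m + 1) → ℕ) :
    blockStart c (Fin.last m) + c (Fin.last m) = ∑ j, c j := by
  rw [blockStart_last, Fin.sum_univ_castSucc]

theorem blockStart_add_le_sum (c : Fin m → ℕ) (i : Fin m) :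
    blockStart c i + c i ≤ ∑ j, c j := by
  unfold blockStart
  rw [add_comm, ← Finset.sum_insert (s := Finset.univ.filter (· < i)) (by simp)]
  exact Finset.sum_le_sum_of_subset (Finset.subset_univ _)

theorem exists_mem_block (c : Fin m → ℕ) {e : ℕ} (he : e ∈ Set.Icc 1 (∑ i, c i)) :
    ∃ i, e ∈ block c i := by
  induction m with
  | zero => simp at he
  | succ m ih =>
    simp only [Set.mem_Icc] at he
    by_cases h : e ≤ ∑ i : Fin m, c i.castSucc
    · obtain ⟨i, hi⟩ := ih (fun i => c i.castSucc) ⟨he.1, h⟩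
      refine ⟨i.castSucc, ?_⟩
      rwa [block, blockStart_castSucc]
    · refine ⟨Fin.last m, ?_⟩
      rw [block, Set.mem_Ioc, blockStart_last_add, blockStart_last]
      omega

theorem mem_chainIdeal {c b : Fin m → ℕ} {e : ℕ} :
    e ∈ chainIdeal c b ↔ ∃ i, blockStart c i < e ∧ e ≤ blockStart c i + b i := Iff.rfl

theorem mem_chainIdeal_iff {c b : Fin m → ℕ} (hb : b ≤ c) {i : Fin m} {e : ℕ}
    (he : e ∈ block c i) : e ∈ chainIdeal c b ↔ e ≤ blockStart c i + b i := by
  constructor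
  · rintro ⟨j, h1, h2⟩
    have hj : e ∈ block c j := ⟨h1, h2.trans (Nat.add_le_add_left (hb j) _)⟩
    obtain rfl := eq_of_mem_block he hj
    exact h2
  · exact fun h => ⟨i, he.1, h⟩

theorem chainIdeal_inter_block {c b : Fin m → ℕ} (hb : b ≤ c) (i : Fin m) :
    chainIdeal c b ∩ block c i = Set.Ioc (blockStart c i) (blockStart c i + b i) := by
  ext e
  constructor
  · rintro ⟨h, he⟩
    exact ⟨he.1, (mem_chainIdeal_iff hb he).1 h⟩
  · rintro ⟨h1, h2⟩
    exact ⟨⟨i, h1, h2⟩, h1, h2.trans (Nat.add_le_add_left (hb i) _)⟩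

theorem chainHeights_chainIdeal {c b : Fin m → ℕ} (hb : b ≤ c) :
    chainHeights c (chainIdeal c b) = b := by
  funext i
  rw [chainHeights, chainIdeal_inter_block hb, ← Finset.coe_Ioc, Set.ncard_coe_finset]
  simp

theorem chainIdeal_mono (c : Fin m → ℕ) {b b' : Fin m → ℕ} (h : b ≤ b') :
    chainIdeal c b ⊆ chainIdeal c b' := by
  rintro e ⟨i, h1, h2⟩
  exact ⟨i, h1, h2.trans (Nat.add_le_add_left (h i) _)⟩

theorem le_of_chainIdeal_subset {c b b' : Fin m → ℕ} (hb : b ≤ c) (hb' : b' ≤ c)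
    (h : chainIdeal c b ⊆ chainIdeal c b') : b ≤ b' := by
  intro i
  by_contra hlt
  have hlt : b' i < b i := not_le.1 hlt
  have hbi : b i ≤ c i := hb i
  have h1 : blockStart c i + b i ∈ chainIdeal c b := mem_chainIdeal.2 ⟨i, by omega, le_rfl⟩
  have h2 := (mem_chainIdeal_iff hb' (i := i) ⟨by omega, by omega⟩).1 (h h1)
  omega

theorem chainIdeal_sup (c b b' : Fin m → ℕ) :
    chainIdeal c (b ⊔ b') = chainIdeal c b ∪ chainIdeal c b' := by
  ext e
  simp only [Set.mem_union, mem_chainIdeal, ← exists_or, Pi.sup_apply]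
  refine exists_congr fun i => ?_
  rcases le_total (b i) (b' i) with h | h <;> simp only [h, sup_of_le_left, sup_of_le_right] <;> omega

theorem chainIdeal_inf {c b b' : Fin m → ℕ} (hb : b ≤ c) (hb' : b' ≤ c) :
    chainIdeal c (b ⊓ b') = chainIdeal c b ∩ chainIdeal c b' := by
  ext e
  constructor
  · exact fun h => ⟨chainIdeal_mono c inf_le_left h, chainIdeal_mono c inf_le_right h⟩
  · rintro ⟨⟨i, h1, h2⟩, h⟩
    have h3 := (mem_chainIdeal_iff hb' (i := i)
      ⟨h1, h2.trans (Nat.add_le_add_left (hb i) _)⟩).1 h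
    refine ⟨i, h1, ?_⟩
    rcases le_total (b i) (b' i) with h | h <;> simp [h] <;> omega

theorem chainIdeal_zero (c : Fin m → ℕ) : chainIdeal c 0 = ∅ := by
  ext e
  simp [chainIdeal]

theorem chainIdeal_self (c : Fin m → ℕ) : chainIdeal c c = Set.Icc 1 (∑ i, c i) := by
  ext e
  constructor
  · rintro ⟨i, h1, h2⟩
    have := blockStart_add_le_sum c i
    exact ⟨by omega, by omega⟩
  · exact fun h => exists_mem_block c h

theorem chainIdeal_update_succ (c b : Fin m → ℕ) (i : Fin m) :
    chainIdeal c (Function.update b i (b i + 1)) =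
      insert (blockStart c i + b i + 1) (chainIdeal c b) := by
  ext e
  simp only [Set.mem_insert_iff, mem_chainIdeal]
  constructor
  · rintro ⟨j, h1, h2⟩
    rcases eq_or_ne j i with rfl | hj
    · rw [Function.update_self] at h2
      by_cases he : e = blockStart c j + b j + 1
      · exact Or.inl he
      · exact Or.inr ⟨j, h1, by omega⟩
    · rw [Function.update_of_ne hj] at h2
      exact Or.inr ⟨j, h1, h2⟩
  · rintro (rfl | ⟨j, h1, h2⟩)
    · exact ⟨i, by omega, by simp [add_assoc]⟩
    · refine ⟨j, h1, h2.trans (Nat.add_le_add_left ?_ _)⟩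
      rcases eq_or_ne j i with rfl | hj
      · simp
      · simp [hj]

theorem chainIdeal_mem {c b : Fin m → ℕ} (hb : b ≤ c) : chainIdeal c b ∈ chainLattice c :=
  ⟨b, hb, rfl⟩

theorem accessible_chainLattice (c : Fin m → ℕ) {A : Set ℕ} (hA : A ∈ chainLattice c)
    -- The removed element is the top of a chain that meets `A`.
    (hne : A.Nonempty) : ∃ x ∈ A, A \ {x} ∈ chainLattice c := by
  obtain ⟨b, hb, rfl⟩ := hA
  obtain ⟨e, i, h1, h2⟩ := hne
  have hbi := hb i
  set b' := Function.update b i (b i - 1) with hb'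
  have hbb : b = Function.update b' i (b' i + 1) := by
    have : b i - 1 + 1 = b i := by omega
    simp [hb', this]
  have hle : b' ≤ c := by
    intro j
    rcases eq_or_ne j i with rfl | hj
    · simp [hb']; omega
    · simpa [hb', hj] using hb j
  have hins := chainIdeal_update_succ c b' i
  rw [← hbb] at hins
  have hbi' : b' i + 1 = b i := by simp [hb']; omega
  have hnot : blockStart c i + b' i + 1 ∉ chainIdeal c b' := by
    rw [mem_chainIdeal_iff hle (i := i) ⟨by omega, by omega⟩]
    omega
  refine ⟨blockStart c i + b' i + 1, by rw [hins]; exact Set.mem_insert _ _, ?_⟩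
  rw [hins, Set.insert_sdiff_self_of_notMem hnot]
  exact chainIdeal_mem hle

/-- Blocks are disjoint, so a new element affects the height in its own block only. An inequality
suffices, and it also covers an `e` that is already present. -/
theorem chainHeights_insert_le {c b b' : Fin m → ℕ} (hb : b ≤ c) (hb' : b' ≤ c) {e : ℕ}
    (h : chainIdeal c b' = insert e (chainIdeal c b)) :
    ∃ i, b' ≤ Function.update b i (b i + 1) := by
  have he : e ∈ Set.Icc 1 (∑ i, c i) := by
    rw [← chainIdeal_self]
    exact chainIdeal_mono c hb' (h ▸ Set.mem_insert _ _)
  obtain ⟨i, hi⟩ := exists_mem_block c he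
  refine ⟨i, fun j => ?_⟩
  have hj : ∀ j, b' j = (insert e (chainIdeal c b) ∩ block c j).ncard := fun j => by
    rw [← h]; exact (congrFun (chainHeights_chainIdeal hb') j).symm
  have hj' : ∀ j, b j = (chainIdeal c b ∩ block c j).ncard := fun j =>
    (congrFun (chainHeights_chainIdeal hb) j).symm
  rcases eq_or_ne j i with rfl | hne
  · rw [Function.update_self, hj, hj' j, Set.insert_inter_of_mem hi]
    exact Set.ncard_insert_le _ _
  · rw [Function.update_of_ne hne, hj, hj' j, Set.insert_inter_of_notMem]
    exact fun h' => hne (eq_of_mem_block h' hi)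

end Chains

/-! ### Splitting the last chain -/

section Split

variable {m : ℕ}

theorem splitCodim_castSucc_castSucc (c : Fin (m + 1) → ℕ) (i : Fin m) :
    splitCodim c i.castSucc.castSucc = c i.castSucc := by
  simp [splitCodim]

theorem splitCodim_castSucc_last (c : Fin (m + 1) → ℕ) :
    splitCodim c (Fin.last m).castSucc = c (Fin.last m) - 1 := by
  simp [splitCodim]

theorem splitCodim_last (c : Fin (m + 1) → ℕ) : splitCodim c (Fin.last (m + 1)) = 1 := by
  simp [splitCodim]

theorem splitCodim_castSucc_le (c : Fin (m + 1) → ℕ) (i : Fin (m + 1)) :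
    splitCodim c i.castSucc ≤ c i := by
  induction i using Fin.lastCases with
  | last => rw [splitCodim_castSucc_last]; omega
  | cast i => rw [splitCodim_castSucc_castSucc]

theorem blockStart_splitCodim_castSucc (c : Fin (m + 1) → ℕ) (i : Fin (m + 1)) :
    blockStart (splitCodim c) i.castSucc = blockStart c i := by
  rw [blockStart_castSucc]
  refine Finset.sum_congr rfl fun j hj => ?_
  have hlt : j < i := by simpa using hj
  obtain ⟨j, rfl⟩ := Fin.exists_castSucc_eq.2 (hlt.trans_le (Fin.le_last i)).ne
  exact splitCodim_castSucc_castSucc c j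

theorem blockStart_splitCodim_last {c : Fin (m + 1) → ℕ} (hc : 1 ≤ c (Fin.last m)) :
    blockStart (splitCodim c) (Fin.last (m + 1)) + 1 = ∑ i, c i := by
  rw [blockStart_last, Fin.sum_univ_castSucc, Fin.sum_univ_castSucc (f := c),
    splitCodim_castSucc_last]
  simp only [splitCodim_castSucc_castSucc]
  omega

/-- The heights that arise when the last chain is put on top of the last but one. -/
def mergeHeights (b : Fin (m + 2) → ℕ) : Fin (m + 1) → ℕ :=
  Function.update (fun i => b i.castSucc) (Fin.last m)
    (b (Fin.last m).castSucc + b (Fin.last (m + 1)))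

theorem mergeHeights_castSucc (b : Fin (m + 2) → ℕ) (i : Fin m) :
    mergeHeights b i.castSucc = b i.castSucc.castSucc := by
  simp [mergeHeights]

theorem mergeHeights_last (b : Fin (m + 2) → ℕ) :
    mergeHeights b (Fin.last m) = b (Fin.last m).castSucc + b (Fin.last (m + 1)) := by
  simp [mergeHeights]

theorem mergeHeights_le {c : Fin (m + 1) → ℕ} (hc : 1 ≤ c (Fin.last m)) {b : Fin (m + 2) → ℕ}
    (hb : b ≤ splitCodim c) : mergeHeights b ≤ c := by
  intro i
  induction i using Fin.lastCases with
  | last =>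
    have h1 : b _ ≤ splitCodim c _ := hb (Fin.last m).castSucc
    have h2 : b _ ≤ splitCodim c _ := hb (Fin.last (m + 1))
    rw [splitCodim_castSucc_last] at h1
    rw [splitCodim_last] at h2
    rw [mergeHeights_last]
    exact show _ ≤ (_ : ℕ) by omega
  | cast i =>
    rw [mergeHeights_castSucc, ← splitCodim_castSucc_castSucc c]
    exact hb _

/-- The first `m + 1` blocks keep their starting points, and the new last block is the single
element `∑ i, c i`. -/
theorem chainIdeal_splitCodim {c : Fin (m + 1) → ℕ} (hc : 1 ≤ c (Fin.last m))
    {b : Fin (m + 2) → ℕ} (hb : b ≤ splitCodim c) :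
    chainIdeal (splitCodim c) b = chainIdeal c (fun i => b i.castSucc) ∪
      {e | e = ∑ i, c i ∧ b (Fin.last (m + 1)) = 1} := by
  have h1 := blockStart_splitCodim_last hc
  have h2 : b _ ≤ splitCodim c _ := hb (Fin.last (m + 1))
  rw [splitCodim_last] at h2
  ext e
  constructor
  · rintro ⟨i, hi⟩
    induction i using Fin.lastCases with
    | last =>
      rw [Set.mem_Ioc] at hi
      exact Or.inr (show _ ∧ _ by omega)
    | cast i =>
      rw [blockStart_splitCodim_castSucc] at hi
      exact Or.inl ⟨i, hi⟩
  · rintro (⟨i, hi⟩ | ⟨rfl, h3⟩)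
    · refine ⟨i.castSucc, ?_⟩
      rwa [blockStart_splitCodim_castSucc]
    · exact ⟨Fin.last (m + 1), by simp only [Set.mem_Ioc]; omega⟩

theorem chainLattice_splitCodim {c : Fin (m + 1) → ℕ} (hc : 1 ≤ c (Fin.last m)) :
    chainLattice (splitCodim c) = adjoinAtom (chainLattice c) (∑ i, c i) := by
  have hins : ∀ b : Fin (m + 1) → ℕ, b (Fin.last m) + 1 = c (Fin.last m) →
      chainIdeal c (Function.update b (Fin.last m) (c (Fin.last m))) =
        chainIdeal c b ∪ {∑ i, c i} := by
    intro b h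
    rw [← h, chainIdeal_update_succ, add_assoc, h, blockStart_last_add, Set.union_singleton]
  have key : ∀ b : Fin (m + 1) → ℕ, b ≤ c → b (Fin.last m) ≤ c (Fin.last m) - 1 → ∀ ε ≤ 1,
      chainIdeal c b ∪ {e | e = ∑ i, c i ∧ ε = 1} ∈ chainLattice (splitCodim c) := by
    intro b hb hl ε hε
    have hle : (Fin.snoc (α := fun _ => ℕ) b ε : Fin (m + 2) → ℕ) ≤ splitCodim c := by
      intro i
      induction i using Fin.lastCases with
      | last => simpa [splitCodim_last] using hε
      | cast i =>
        induction i using Fin.lastCases with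
        | last => simpa [splitCodim_castSucc_last] using hl
        | cast i => simpa [splitCodim_castSucc_castSucc] using hb _
    refine ⟨_, hle, ?_⟩
    rw [chainIdeal_splitCodim hc hle]
    simp
  -- A full last chain does not fit into the shortened block; its top element is moved to the new
  -- block.
  have key2 : ∀ b : Fin (m + 1) → ℕ, b ≤ c → b (Fin.last m) = c (Fin.last m) →
      ∃ b', b' ≤ c ∧ b' (Fin.last m) ≤ c (Fin.last m) - 1 ∧
        chainIdeal c b = chainIdeal c b' ∪ {∑ i, c i} := by
    intro b hb h
    refine ⟨Function.update b (Fin.last m) (c (Fin.last m) - 1), ?_, by simp, ?_⟩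
    · intro i
      induction i using Fin.lastCases with
      | last => simp
      | cast i => simpa [Function.update_of_ne (Fin.castSucc_ne_last i)] using hb _
    · rw [← hins _ (by rw [Function.update_self]; omega)]
      congr 1
      rw [Function.update_idem, ← h, Function.update_eq_self]
  ext S
  constructor
  · rintro ⟨b, hb, rfl⟩
    rw [chainIdeal_splitCodim hc hb]
    have hle : (fun i : Fin (m + 1) => b i.castSucc) ≤ c := fun i =>
      (hb _).trans (splitCodim_castSucc_le c i)
    by_cases h : b (Fin.last (m + 1)) = 1
    · refine Or.inr ⟨_, chainIdeal_mem hle, by simp [h]⟩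
    · refine Or.inl ⟨_, hle, by simp [h]⟩
  · rintro (⟨b, hb, rfl⟩ | ⟨_, ⟨b, hb, rfl⟩, rfl⟩)
    · by_cases h : b (Fin.last m) = c (Fin.last m)
      · obtain ⟨b', h1, h2, h3⟩ := key2 b hb h
        rw [h3]
        simpa using key b' h1 h2 1 le_rfl
      · have := hb (Fin.last m)
        simpa using key b hb (by omega) 0 zero_le_one
    · by_cases h : b (Fin.last m) = c (Fin.last m)
      · obtain ⟨b', h1, h2, h3⟩ := key2 b hb h
        rw [h3, Set.union_assoc, Set.union_self]
        simpa using key b' h1 h2 1 le_rfl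
      · have := hb (Fin.last m)
        simpa using key b hb (by omega) 1 le_rfl

theorem singleton_sum_notMem_chainLattice {c : Fin (m + 1) → ℕ} (hc : 2 ≤ c (Fin.last m)) :
    {∑ i, c i} ∉ chainLattice c := by
  rintro ⟨b, hb, h⟩
  have hs := blockStart_last_add c
  have h1 : ∑ i, c i ∈ chainIdeal c b := h ▸ rfl
  have h2 := (mem_chainIdeal_iff hb (i := Fin.last m) ⟨by omega, by omega⟩).1 h1
  have h3 : ∑ i, c i - 1 ∈ chainIdeal c b := ⟨Fin.last m, by simp only [Set.mem_Ioc]; omega⟩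
  rw [← h, Set.mem_singleton_iff] at h3
  omega

/-- The top element of the last block forces all of that block. -/
theorem latticeSup_chainIdeal_union {c b : Fin (m + 1) → ℕ} (hc : 1 ≤ c (Fin.last m))
    (hb : b ≤ c) :
    latticeSup (chainLattice c) (chainIdeal c b ∪ {∑ i, c i}) =
      chainIdeal c (Function.update b (Fin.last m) (c (Fin.last m))) := by
  have hs := blockStart_last_add c
  have hle : Function.update b (Fin.last m) (c (Fin.last m)) ≤ c :=
    update_le_iff.2 ⟨le_rfl, fun i _ => hb i⟩
  have hbu : b ≤ Function.update b (Fin.last m) (c (Fin.last m)) :=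
    le_update_iff.2 ⟨hb _, fun i _ => le_rfl⟩
  apply subset_antisymm
  · refine Set.sInter_subset_of_mem ⟨chainIdeal_mem hle, Set.union_subset (chainIdeal_mono c hbu) ?_⟩
    rw [Set.singleton_subset_iff]
    exact ⟨Fin.last m, by simp only [Set.mem_Ioc, Function.update_self]; omega⟩
  · refine Set.subset_sInter ?_
    rintro _ ⟨⟨b', hb', rfl⟩, hsub⟩
    refine chainIdeal_mono c (update_le_iff.2 ⟨?_, fun i _ => ?_⟩)
    · have := (mem_chainIdeal_iff hb' (i := Fin.last m) ⟨by omega, by omega⟩).1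
        (hsub (Or.inr rfl))
      omega
    · exact le_of_chainIdeal_subset hb hb' (Set.subset_union_left.trans hsub) i

theorem sum_notMem_chainIdeal {c b : Fin (m + 1) → ℕ} (hb : b ≤ c)
    (h : b (Fin.last m) < c (Fin.last m)) : ∑ i, c i ∉ chainIdeal c b := by
  have hs := blockStart_last_add c
  rw [mem_chainIdeal_iff hb (i := Fin.last m) ⟨by omega, by omega⟩]
  omega

/-- The element just below the top is missing, so the set is not an initial segment of the last
block. -/
theorem chainIdeal_union_notMem {c b : Fin (m + 1) → ℕ} (hb : b ≤ c)
    (h : b (Fin.last m) + 1 < c (Fin.last m)) :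
    chainIdeal c b ∪ {∑ i, c i} ∉ chainLattice c := by
  rintro ⟨b', hb', h'⟩
  have hs := blockStart_last_add c
  have h1 := (mem_chainIdeal_iff hb' (i := Fin.last m) (e := ∑ i, c i) ⟨by omega, by omega⟩).1
    (h' ▸ Or.inr rfl)
  have h2 : ∑ i, c i - 1 ∈ chainIdeal c b' :=
    ⟨Fin.last m, by simp only [Set.mem_Ioc]; omega⟩
  rw [← h'] at h2
  rcases h2 with h2 | h2
  · rw [mem_chainIdeal_iff hb (i := Fin.last m) ⟨by omega, by omega⟩] at h2
    omega
  · rw [Set.mem_singleton_iff] at h2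
    omega

end Split

/-! ### Zariski-open rank conditions -/

section Zariski

open scoped Topology

variable {k : Type*} [Field k] {W U : Type*} [AddCommGroup W] [Module k W]
  [AddCommGroup U] [Module k U]

theorem exists_polynomial_of_mem_polyFun {f : W → k} (hf : f ∈ polyFun k W) (w₀ w₁ : W) :
    ∃ p : Polynomial k, ∀ t, f (w₀ + t • w₁) = p.eval t := by
  induction hf using Algebra.adjoin_induction with
  | mem f hf =>
    obtain ⟨φ, rfl⟩ := hf
    exact ⟨Polynomial.C (φ w₀) + Polynomial.X * Polynomial.C (φ w₁), fun t => by simp [mul_comm t]⟩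
  | algebraMap r => exact ⟨Polynomial.C r, fun t => by rw [Polynomial.eval_C]; rfl⟩
  | add f g _ _ hf hg =>
    obtain ⟨p, hp⟩ := hf
    obtain ⟨q, hq⟩ := hg
    exact ⟨p + q, fun t => by simp [hp, hq]⟩
  | mul f g _ _ hf hg =>
    obtain ⟨p, hp⟩ := hf
    obtain ⟨q, hq⟩ := hg
    exact ⟨p * q, fun t => by simp [hp, hq]⟩

theorem dual_mem_polyFun (φ : Module.Dual k W) : (fun w => φ w) ∈ polyFun k W :=
  Algebra.subset_adjoin ⟨φ, rfl⟩

theorem isOpen_zariski_ne_zero {f : W → k} (hf : f ∈ polyFun k W) :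
    IsOpen[zariski k W] {w | f w ≠ 0} :=
  TopologicalSpace.isOpen_generateFrom_of_mem ⟨f, hf, rfl⟩

theorem exists_polyFun_of_isOpen {G : Set W} (hG : IsOpen[zariski k W] G) {w : W} (hw : w ∈ G) :
    ∃ f ∈ polyFun k W, f w ≠ 0 ∧ ∀ x, f x ≠ 0 → x ∈ G := by
  induction hG with
  | basic s hs =>
    obtain ⟨f, hf, rfl⟩ := hs
    exact ⟨f, hf, hw, fun _ => id⟩
  | univ => exact ⟨1, one_mem _, one_ne_zero, fun _ _ => trivial⟩
  | inter s t _ _ hs ht =>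
    obtain ⟨f, hf, h1, h2⟩ := hs hw.1
    obtain ⟨g, hg, h3, h4⟩ := ht hw.2
    exact ⟨f * g, mul_mem hf hg, mul_ne_zero h1 h3, fun x hx =>
      ⟨h2 x (left_ne_zero_of_mul hx), h4 x (right_ne_zero_of_mul hx)⟩⟩
  | sUnion S _ ih =>
    obtain ⟨s, hs, hws⟩ := hw
    obtain ⟨f, hf, h1, h2⟩ := ih s hs hws
    exact ⟨f, hf, h1, fun x hx => ⟨s, hs, h2 x hx⟩⟩

/-- A line through points of two Zariski-open sets meets their intersection. -/
theorem exists_line_mem_inter [Infinite k] {G₀ G₁ : Set W} (h₀ : IsOpen[zariski k W] G₀)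
    (h₁ : IsOpen[zariski k W] G₁) {w₀ w₁ : W} (hw₀ : w₀ ∈ G₀) (hw₁ : w₁ ∈ G₁) :
    ∃ t : k, w₀ + t • (w₁ - w₀) ∈ G₀ ∩ G₁ := by
  obtain ⟨f, hf, hf0, hfG⟩ := exists_polyFun_of_isOpen h₀ hw₀
  obtain ⟨g, hg, hg0, hgG⟩ := exists_polyFun_of_isOpen h₁ hw₁
  obtain ⟨p, hp⟩ := exists_polynomial_of_mem_polyFun hf w₀ (w₁ - w₀)
  obtain ⟨q, hq⟩ := exists_polynomial_of_mem_polyFun hg w₀ (w₁ - w₀)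
  -- The restrictions to the line are nonzero at parameter 0 and at parameter 1 respectively, and a
  -- nonzero polynomial over an infinite field has a nonroot.
  have hp0 : p ≠ 0 := by
    rintro rfl
    exact hf0 (by simpa using hp 0)
  have hq0 : q ≠ 0 := by
    rintro rfl
    exact hg0 (by simpa using hq 1)
  obtain ⟨t, ht⟩ : ∃ t : k, (p * q).eval t ≠ 0 := by
    by_contra! h
    exact mul_ne_zero hp0 hq0 (Polynomial.funext fun t => by simpa using h t)
  rw [Polynomial.eval_mul, ← hp, ← hq] at ht
  exact ⟨t, hfG _ (left_ne_zero_of_mul ht), hgG _ (right_ne_zero_of_mul ht)⟩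

theorem iInter_nonempty_of_isOpen_zariski [Infinite k] {ι : Type*} [Finite ι] {G : ι → Set W}
    (hG : ∀ i, IsOpen[zariski k W] (G i)) (hne : ∀ i, (G i).Nonempty) :
    (⋂ i, G i).Nonempty := by
  classical
  cases nonempty_fintype ι
  let _ := zariski k W
  suffices h : ∀ s : Finset ι, (⋂ i ∈ s, G i).Nonempty by simpa using h Finset.univ
  intro s
  induction s using Finset.induction_on with
  | empty => exact ⟨0, by simp⟩
  | insert i s _ ih =>
    obtain ⟨w₀, h₀⟩ := ih
    obtain ⟨w₁, h₁⟩ := hne i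
    obtain ⟨t, ht⟩ := exists_line_mem_inter
      (isOpen_biInter_finset (s := s) fun i _ => hG i) (hG i) h₀ h₁
    rw [Finset.set_biInter_insert]
    exact ⟨_, ht.2, ht.1⟩

theorem isOpen_zariski_linearIndependent [FiniteDimensional k U] {ι : Type*} [Finite ι]
    (L : ι → W →ₗ[k] U) :
    IsOpen[zariski k W] {w | LinearIndependent k fun i => L i w} := by
  classical
  cases nonempty_fintype ι
  let _ := zariski k W
  rw [isOpen_iff_forall_mem_open]
  intro w hw
  -- In the coordinates `φ` adapted to `w`, the determinant of the family is a polynomial function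
  -- equal to 1 at `w`. Where it does not vanish, the family is independent.
  obtain ⟨φ, hφ⟩ : ∃ φ : U →ₗ[k] (ι → k), ∀ i, φ (L i w) = Pi.single i 1 := by
    obtain ⟨φ, hφ⟩ := ((Module.Basis.span hw).constr k fun i => (Pi.single i 1 : ι → k)).exists_extend
    refine ⟨φ, fun i => ?_⟩
    have := LinearMap.congr_fun hφ (Module.Basis.span hw i)
    rw [Module.Basis.constr_basis] at this
    rw [← this]
    simp [Module.Basis.span_apply]
  let D : W → k := fun x => (Matrix.of fun i j => φ (L i x) j).det
  have hD : D ∈ polyFun k W := by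
    have : D = ∑ σ : Equiv.Perm ι, (Equiv.Perm.sign σ : ℤ) •
        ∏ i, fun x => (LinearMap.proj i ∘ₗ φ ∘ₗ L (σ i)) x := by
      funext x
      simp [D, Matrix.det_apply, Finset.sum_apply, Finset.prod_apply, Units.smul_def]
    rw [this]
    exact sum_mem fun σ _ => zsmul_mem ((polyFun k W).prod_mem fun i _ => dual_mem_polyFun _) _
  refine ⟨{x | D x ≠ 0}, fun x hx => ?_, isOpen_zariski_ne_zero hD, ?_⟩
  · have h1 : LinearIndependent k (Matrix.of fun i j => φ (L i x) j).row :=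
      Matrix.linearIndependent_rows_of_det_ne_zero hx
    exact LinearIndependent.of_comp φ h1
  · have : (Matrix.of fun i j => φ (L i w) j) = 1 := by
      ext i j
      simp [hφ, Matrix.one_apply, Pi.single_apply, eq_comm]
    simp [D, this]

theorem isOpen_zariski_le_finrank_span [FiniteDimensional k U] {ι : Type*} (L : ι → W →ₗ[k] U)
    (r : ℕ) :
    IsOpen[zariski k W]
      {w | r ≤ Module.finrank k (Submodule.span k (Set.range fun i => L i w))} := by
  let _ := zariski k W
  rw [isOpen_iff_forall_mem_open]
  intro w hw
  -- A subfamily that is a basis of the span at `w` stays independent nearby, so the rank cannot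
  -- drop.
  obtain ⟨κ, a, ha, hspan, hli⟩ := exists_linearIndependent' k fun i => L i w
  have : Finite κ := hli.finite
  cases nonempty_fintype κ
  refine ⟨_, fun x hx => ?_, isOpen_zariski_linearIndependent fun j => L (a j), hli⟩
  have h1 : r ≤ Fintype.card κ := by
    rw [← finrank_span_eq_card hli, hspan]
    exact hw
  refine h1.trans ?_
  rw [← finrank_span_eq_card hx]
  refine Submodule.finrank_mono (Submodule.span_mono ?_)
  rintro _ ⟨j, rfl⟩
  exact ⟨a j, rfl⟩

/-- Each rank bound is a nonempty open condition on the linear space of tuples with `w i ∈ A i`.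
Finitely many bounds, each attainable by itself, are thus attainable together. -/
theorem exists_mem_forall_le_finrank_span [Infinite k] [FiniteDimensional k U] {ι κ : Type*}
    [Finite κ] (A : ι → Submodule k U) {T : κ → Set ι} {r : κ → ℕ}
    (h : ∀ j, ∃ w : ι → U, (∀ i, w i ∈ A i) ∧
      r j ≤ Module.finrank k (Submodule.span k (w '' T j))) :
    ∃ w : ι → U, (∀ i, w i ∈ A i) ∧
      ∀ j, r j ≤ Module.finrank k (Submodule.span k (w '' T j)) := by
  let L : ι → ((i : ι) → A i) →ₗ[k] U := fun i => (A i).subtype ∘ₗ LinearMap.proj i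
  obtain ⟨w, hw⟩ := iInter_nonempty_of_isOpen_zariski
    (fun j => isOpen_zariski_le_finrank_span (fun i : T j => L i) (r j)) (by
      intro j
      obtain ⟨w, hwA, hw⟩ := h j
      refine ⟨fun i => ⟨w i, hwA i⟩, ?_⟩
      rw [Set.image_eq_range] at hw
      exact hw)
  refine ⟨fun i => w i, fun i => (w i).2, fun j => ?_⟩
  rw [Set.image_eq_range]
  exact Set.mem_iInter.1 hw j

theorem exists_basis_vectors {S : Submodule k U} [FiniteDimensional k U] {n : ℕ}
    (h : Module.finrank k S = n) :
    ∃ β : Fin n → U, LinearIndependent k β ∧ Submodule.span k (Set.range β) = S := by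
  let β : Module.Basis (Fin n) k S := Module.finBasisOfFinrankEq k S h
  refine ⟨fun p => β p, β.linearIndependent.map' S.subtype (Submodule.ker_subtype _), ?_⟩
  have := congrArg (Submodule.map S.subtype) β.span_eq
  rwa [Submodule.map_span, Submodule.map_top, Submodule.range_subtype, ← Set.range_comp] at this

/-- The `p`-th vector of the `i`-th list, as a linear function of the tuple of lists. -/
def vectorEntry (k U : Type*) [Field k] [AddCommGroup U] [Module k U] {m : ℕ} (c : Fin m → ℕ)
    (i : Fin m) (p : Fin (c i)) : ((i : Fin m) → Fin (c i) → U) →ₗ[k] U :=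
  (LinearMap.proj p : (Fin (c i) → U) →ₗ[k] U) ∘ₗ LinearMap.proj i

theorem isOpen_forall_linearIndependent [FiniteDimensional k U] {m : ℕ} (c : Fin m → ℕ) :
    IsOpen[zariski k ((i : Fin m) → Fin (c i) → U)] {w | ∀ i, LinearIndependent k (w i)} := by
  let _ := zariski k ((i : Fin m) → Fin (c i) → U)
  rw [Set.ofPred_forall]
  exact isOpen_iInter_of_finite fun i =>
    isOpen_zariski_linearIndependent (vectorEntry k U c i)

theorem isOpen_le_finrank_span_sup [FiniteDimensional k U] {m : ℕ} (c : Fin m → ℕ) (i j : Fin m)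
    (r : ℕ) :
    IsOpen[zariski k ((i : Fin m) → Fin (c i) → U)]
      {w | r ≤ Module.finrank k (Submodule.span k (Set.range (w i)) ⊔
        Submodule.span k (Set.range (w j)) : Submodule k U)} := by
  let L := Sum.elim (vectorEntry k U c i) (vectorEntry k U c j)
  have hL : ∀ w, Submodule.span k (Set.range (w i)) ⊔ Submodule.span k (Set.range (w j)) =
      Submodule.span k (Set.range fun x => L x w) := fun w => by
    rw [← Submodule.span_union, ← Set.Sum.elim_range]
    congr 2
    funext x
    cases x <;> rfl
  convert isOpen_zariski_le_finrank_span L r using 1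
  ext w
  rw [Set.mem_ofPred_eq, Set.mem_ofPred_eq, hL]

/-- Having a rank condition satisfied by some combinations with the given coefficients is open. -/
theorem isOpen_le_finrank_span_combination [FiniteDimensional k U] {m : ℕ} {c b : Fin m → ℕ}
    (M : (i : Fin m) → Fin (b i) → Fin (c i) → k) (r : ℕ) :
    IsOpen[zariski k ((i : Fin m) → Fin (c i) → U)]
      {w | r ≤ Module.finrank k (⨆ i, Submodule.span k
        (Set.range fun q => ∑ p, M i q p • w i p) : Submodule k U)} := by
  let L (x : Σ i, Fin (b i)) : ((i : Fin m) → Fin (c i) → U) →ₗ[k] U :=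
    ∑ p, M x.1 x.2 p • vectorEntry k U c x.1 p
  have hL : ∀ w : (i : Fin m) → Fin (c i) → U, (⨆ i, Submodule.span k
      (Set.range fun q => ∑ p, M i q p • w i p)) =
      Submodule.span k (Set.range fun x => L x w) := fun w => by
    rw [← Submodule.span_iUnion, Set.range_sigma_eq_iUnion_range]
    simp [L, LinearMap.sum_apply, vectorEntry]
  convert isOpen_zariski_le_finrank_span L r using 1
  ext w
  rw [Set.mem_ofPred_eq, Set.mem_ofPred_eq, hL]

end Zariski

/-! ### The rank function of an arrangement via generic vectors -/

section Arrangements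

open Module

variable {k : Type*} [Field k] {V : Type*} [AddCommGroup V] [Module k V] {m : ℕ}

theorem exists_between_finrank_eq {S A : Submodule k V} [FiniteDimensional k V] (hSA : S ≤ A)
    {n : ℕ} (hS : finrank k S ≤ n) (hA : n ≤ finrank k A) :
    ∃ B, S ≤ B ∧ B ≤ A ∧ finrank k B = n := by
  induction n, hS using Nat.le_induction with
  | base => exact ⟨S, le_rfl, hSA, rfl⟩
  | succ n _ ih =>
    obtain ⟨B, h1, h2, h3⟩ := ih (Nat.le_of_succ_le hA)
    obtain ⟨x, hxA, hxB⟩ : ∃ x ∈ A, x ∉ B := by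
      by_contra! h
      rw [le_antisymm h2 h] at h3
      omega
    refine ⟨B ⊔ k ∙ x, h1.trans le_sup_left,
      sup_le h2 ((Submodule.span_singleton_le_iff_mem _ _).2 hxA), ?_⟩
    have hdisj : B ⊓ k ∙ x = ⊥ := by
      rw [← disjoint_iff, Submodule.disjoint_span_singleton]
      exact fun h => absurd h hxB
    have h4 := Submodule.finrank_sup_add_finrank_inf_eq B (k ∙ x)
    rw [hdisj, finrank_bot, finrank_span_singleton (by rintro rfl; exact hxB B.zero_mem)] at h4
    omega

theorem exists_generic_vectors [Infinite k] {U : Type*} [AddCommGroup U] [Module k U]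
    [FiniteDimensional k U] {c : Fin m → ℕ} (A : Fin m → Submodule k U) (R : (Fin m → ℕ) → ℕ)
    (hR : ∀ b ≤ c, ∃ B : Fin m → Submodule k U, (∀ i, B i ≤ A i) ∧ (∀ i, finrank k (B i) = b i) ∧
      R b ≤ finrank k (⨆ i, B i : Submodule k U)) :
    ∃ v : Fin m → ℕ → U, (∀ i p, v i p ∈ A i) ∧
      ∀ T : Fin m → Finset ℕ, (∀ i, T i ⊆ Finset.range (c i)) →
        R (fun i => (T i).card) ≤
          finrank k (⨆ i, Submodule.span k (v i '' T i) : Submodule k U) := by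
  classical
  have hbasis : ∀ T : (i : Fin m) → Finset (Fin (c i)), ∃ w : (Σ i, Fin (c i)) → U,
      (∀ x, w x ∈ A x.1) ∧ (R fun i => (T i).card) ≤
        finrank k (Submodule.span k (w '' {x | x.2 ∈ T x.1})) := by
    intro T
    have hT : (fun i => (T i).card) ≤ c := fun i => by
      simpa using Finset.card_le_univ (T i)
    obtain ⟨B, h1, h2, h3⟩ := hR _ hT
    choose β _ hβ using fun i => exists_basis_vectors (h2 i)
    -- For one fixed `T`, spread a basis of an optimal `B i` over the positions in `T i`; entries
    -- outside `T` play no role.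
    refine ⟨fun x => if h : x.2 ∈ T x.1 then β x.1 ((T x.1).equivFin ⟨x.2, h⟩) else 0,
      fun x => ?_, ?_⟩
    · by_cases h : x.2 ∈ T x.1
      · simpa [h] using h1 _ (hβ x.1 ▸ Submodule.subset_span ⟨_, rfl⟩)
      · simp [h]
    refine h3.trans (Submodule.finrank_mono (iSup_le fun i => ?_))
    rw [← hβ i]
    refine Submodule.span_mono ?_
    rintro _ ⟨q, rfl⟩
    obtain ⟨⟨p, hp⟩, rfl⟩ := (T i).equivFin.surjective q
    exact ⟨⟨i, p⟩, hp, dif_pos hp⟩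
  obtain ⟨w, hwA, hw⟩ := exists_mem_forall_le_finrank_span (fun x : Σ i, Fin (c i) => A x.1)
    hbasis
  refine ⟨fun i p => if h : p < c i then w ⟨i, p, h⟩ else 0, fun i p => ?_, fun T hT => ?_⟩
  · by_cases h : p < c i
    · simpa [h] using hwA ⟨i, p, h⟩
    · simp [h]
  · have hlt : ∀ i, ∀ p ∈ T i, p < c i := fun i p hp => Finset.mem_range.1 (hT i hp)
    have h := hw fun i => (T i).attachFin (hlt i)
    simp only [Finset.card_attachFin] at h
    refine h.trans (Submodule.finrank_mono ?_)
    rw [Submodule.span_le]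
    rintro _ ⟨⟨i, p⟩, hp, rfl⟩
    exact Submodule.mem_iSup_of_mem i (Submodule.subset_span
      ⟨p, (Finset.mem_attachFin (hlt i)).1 hp, dif_pos p.2⟩)

/-- The space of the linear forms that vanish on the `i`-th member of an arrangement. -/
abbrev Gr.ann {c : Fin m → ℕ} (X : Gr k V c) (i : Fin m) : Submodule k (Dual k V) :=
  (X.space i).dualAnnihilator

theorem rho_chainIdeal {c : Fin m → ℕ} (X : Gr k V c) {b : Fin m → ℕ} (hb : b ≤ c) :
    rho X (chainIdeal c b) = rhoTuple X b := by
  rw [rho, chainHeights_chainIdeal hb]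

theorem finrank_span_image_le (u : ℕ → Dual k V) (T : Finset ℕ) :
    finrank k (Submodule.span k (u '' T)) ≤ T.card := by
  classical
  rw [← Finset.coe_image]
  exact (finrank_span_finset_le_card _).trans Finset.card_image_le

variable [FiniteDimensional k V] {c : Fin m → ℕ}

theorem finrank_dualAnnihilator (S : Submodule k V) :
    finrank k S.dualAnnihilator = finrank k (V ⧸ S) := by
  have h1 := Subspace.finrank_add_finrank_dualAnnihilator_eq S
  have h2 := Submodule.finrank_quotient_add_finrank S
  omega

theorem Gr.finrank_ann (X : Gr k V c) (i : Fin m) : finrank k (X.ann i) = c i :=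
  (finrank_dualAnnihilator _).trans (X.codim_eq i)

theorem finrank_quotient_iInf (Y : Fin m → Submodule k V) :
    finrank k (V ⧸ (⨅ i, Y i)) = finrank k (⨆ i, (Y i).dualAnnihilator : Submodule k (Dual k V)) := by
  rw [← finrank_dualAnnihilator, Subspace.dualAnnihilator_iInf_eq]

theorem rhoTuple_bddAbove (X : Gr k V c) (b : Fin m → ℕ) :
    BddAbove {r | ∃ Y : Gr k V b, (∀ i, X.space i ≤ Y.space i) ∧
      r = finrank k (V ⧸ (⨅ i, Y.space i))} := by
  refine ⟨finrank k V, ?_⟩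
  rintro _ ⟨Y, -, rfl⟩
  exact Submodule.finrank_quotient_le _

/-- A `B i` that is too small can be enlarged inside the annihilator, so `≤ b i` suffices in the
hypothesis. This is convenient for spans whose exact dimension is unknown. -/
theorem finrank_iSup_le_rhoTuple (X : Gr k V c) {b : Fin m → ℕ} (hb : b ≤ c)
    {B : Fin m → Submodule k (Dual k V)} (hB : ∀ i, B i ≤ X.ann i)
    (hBb : ∀ i, finrank k (B i) ≤ b i) :
    finrank k (⨆ i, B i : Submodule k (Dual k V)) ≤ rhoTuple X b := by
  have h : ∀ i, ∃ C, B i ≤ C ∧ C ≤ X.ann i ∧ finrank k C = b i := fun i =>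
    exists_between_finrank_eq (hB i) (hBb i) (X.finrank_ann i ▸ hb i)
  choose C h1 h2 h3 using h
  have h4 : ∀ i, (C i).dualCoannihilator.dualAnnihilator = C i := fun i =>
    Subspace.dualCoannihilator_dualAnnihilator_eq
  let Y : Gr k V b := ⟨fun i => (C i).dualCoannihilator, fun i => by
    rw [← finrank_dualAnnihilator, h4, h3]⟩
  have hY : ∀ i, X.space i ≤ Y.space i := fun i =>
    (Submodule.le_dualAnnihilator_iff_le_dualCoannihilator).1 (h2 i)
  refine le_trans ?_ (le_csSup (rhoTuple_bddAbove X b) ⟨Y, hY, rfl⟩)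
  rw [finrank_quotient_iInf]
  refine Submodule.finrank_mono (iSup_mono fun i => ?_)
  exact (h1 i).trans (h4 i).ge

theorem exists_finrank_iSup_eq_rhoTuple (X : Gr k V c) {b : Fin m → ℕ} (hb : b ≤ c) :
    ∃ B : Fin m → Submodule k (Dual k V), (∀ i, B i ≤ X.ann i) ∧ (∀ i, finrank k (B i) = b i) ∧
      finrank k (⨆ i, B i : Submodule k (Dual k V)) = rhoTuple X b := by
  have hne : {r | ∃ Y : Gr k V b, (∀ i, X.space i ≤ Y.space i) ∧
      r = finrank k (V ⧸ (⨅ i, Y.space i))}.Nonempty := by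
    have h : ∀ i, ∃ C, ⊥ ≤ C ∧ C ≤ X.ann i ∧ finrank k C = b i := fun i =>
      exists_between_finrank_eq bot_le (by simp) (X.finrank_ann i ▸ hb i)
    choose C _ h2 h3 using h
    refine ⟨_, ⟨fun i => (C i).dualCoannihilator, fun i => ?_⟩, fun i => ?_, rfl⟩
    · rw [← finrank_dualAnnihilator, Subspace.dualCoannihilator_dualAnnihilator_eq, h3]
    · exact (Submodule.le_dualAnnihilator_iff_le_dualCoannihilator).1 (h2 i)
  obtain ⟨Y, hY, hr⟩ := Nat.sSup_mem hne (rhoTuple_bddAbove X b)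
  exact ⟨Y.ann, fun i => Submodule.dualAnnihilator_anti (hY i), Y.finrank_ann,
    (finrank_quotient_iInf _).symm.trans hr.symm⟩

theorem rhoTuple_mono (X : Gr k V c) {b b' : Fin m → ℕ} (h : b ≤ b') (hb' : b' ≤ c) :
    rhoTuple X b ≤ rhoTuple X b' := by
  obtain ⟨B, h1, h2, h3⟩ := exists_finrank_iSup_eq_rhoTuple X (h.trans hb')
  rw [← h3]
  exact finrank_iSup_le_rhoTuple X hb' h1 fun i => (h2 i).le.trans (h i)

theorem rhoTuple_zero (X : Gr k V c) : rhoTuple X 0 = 0 := by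
  obtain ⟨B, h1, h2, h3⟩ := exists_finrank_iSup_eq_rhoTuple X (zero_le : 0 ≤ c)
  have : ∀ i, B i = ⊥ := fun i => Submodule.finrank_eq_zero.1 (h2 i)
  rw [← h3]
  simp [this]

/-- Generic vectors in the spaces of equations of an arrangement compute its rank function. -/
theorem exists_generic [Infinite k] (X : Gr k V c) :
    ∃ v : Fin m → ℕ → Dual k V, (∀ i p, v i p ∈ X.ann i) ∧
      ∀ T : Fin m → Finset ℕ, (∀ i, T i ⊆ Finset.range (c i)) →
        finrank k (⨆ i, Submodule.span k (v i '' T i) : Submodule k (Dual k V)) =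
          rhoTuple X fun i => (T i).card := by
  obtain ⟨v, hvA, hv⟩ := exists_generic_vectors (c := c) X.ann (rhoTuple X) fun b hb => by
    obtain ⟨B, h1, h2, h3⟩ := exists_finrank_iSup_eq_rhoTuple X hb
    exact ⟨B, h1, h2, h3.ge⟩
  refine ⟨v, hvA, fun T hT => le_antisymm ?_ (hv T hT)⟩
  refine finrank_iSup_le_rhoTuple X (fun i => ?_) (fun i => ?_) fun i => finrank_span_image_le _ _
  · simpa using Finset.card_le_card (hT i)
  · rw [Submodule.span_le]
    rintro _ ⟨p, -, rfl⟩
    exact hvA i p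

theorem exists_generic_flags [Infinite k] (X : Gr k V c) :
    ∃ v : Fin m → ℕ → Dual k V, ∀ b ≤ c,
        finrank k (⨆ i, Submodule.span k (v i '' Finset.range (b i)) : Submodule k (Dual k V)) =
          rhoTuple X b := by
  obtain ⟨v, -, hv⟩ := exists_generic X
  refine ⟨v, fun b hb => ?_⟩
  rw [hv _ fun i => Finset.range_subset_range.2 (hb i)]
  simp

/-- One family of generic vectors computes all four values. The span for the supremum lies in the
sum of the spans, the span for the infimum lies in their intersection, and the dimension formula
concludes. -/
theorem rhoTuple_submodular [Infinite k] (X : Gr k V c) {b b' : Fin m → ℕ} (hb : b ≤ c)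
    (hb' : b' ≤ c) :
    rhoTuple X (b ⊔ b') + rhoTuple X (b ⊓ b') ≤ rhoTuple X b + rhoTuple X b' := by
  obtain ⟨v, hv⟩ := exists_generic_flags X
  rw [← hv _ hb, ← hv _ hb', ← hv _ (sup_le hb hb'), ← hv _ (inf_le_left.trans hb),
    ← Submodule.finrank_sup_add_finrank_inf_eq (⨆ i, Submodule.span k (v i '' Finset.range (b i)))]
  have hmono : ∀ {b b' : Fin m → ℕ}, b ≤ b' →
      (⨆ i, Submodule.span k (v i '' Finset.range (b i))) ≤
        ⨆ i, Submodule.span k (v i '' Finset.range (b' i)) := fun h => iSup_mono fun i =>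
    Submodule.span_mono (Set.image_mono (Finset.coe_subset.2 (Finset.range_subset_range.2 (h i))))
  refine Nat.add_le_add (Submodule.finrank_mono (iSup_le fun i => ?_))
    (Submodule.finrank_mono (le_inf (hmono inf_le_left) (hmono inf_le_right)))
  rcases le_total (b i) (b' i) with h | h
  · rw [Pi.sup_apply, sup_of_le_right h]
    exact le_sup_of_le_right (le_iSup (fun i => Submodule.span k (v i '' Finset.range (b' i))) i)
  · rw [Pi.sup_apply, sup_of_le_left h]
    exact le_sup_of_le_left (le_iSup (fun i => Submodule.span k (v i '' Finset.range (b i))) i)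

theorem finrank_sup_span_singleton_le (S : Submodule k (Dual k V)) (x : Dual k V) :
    finrank k (S ⊔ k ∙ x : Submodule k (Dual k V)) ≤ finrank k S + 1 :=
  (Submodule.finrank_add_le_finrank_add_finrank S (k ∙ x)).trans
    (Nat.add_le_add_left ((finrank_span_le_card {x}).trans (by simp)) _)

theorem rhoTuple_update_succ_le [Infinite k] (X : Gr k V c) {b : Fin m → ℕ} (hb : b ≤ c)
    {i : Fin m} (hi : b i < c i) :
    rhoTuple X (Function.update b i (b i + 1)) ≤ rhoTuple X b + 1 := by
  obtain ⟨v, hv⟩ := exists_generic_flags X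
  rw [← hv _ hb, ← hv _ (update_le_iff.2 ⟨hi, fun j _ => hb j⟩)]
  refine le_trans (Submodule.finrank_mono (iSup_le fun j => ?_))
    (finrank_sup_span_singleton_le _ (v i (b i)))
  rcases eq_or_ne j i with rfl | hj
  · rw [Function.update_self, Finset.range_add_one, Finset.coe_insert, Set.image_insert_eq,
      Submodule.span_insert, sup_comm]
    exact sup_le_sup_right (le_iSup (fun i => Submodule.span k (v i '' Finset.range (b i))) j) _
  · rw [Function.update_of_ne hj]
    exact le_sup_of_le_left (le_iSup (fun i => Submodule.span k (v i '' Finset.range (b i))) j)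

theorem rhoTuple_le_add_one [Infinite k] (X : Gr k V c) {b b' : Fin m → ℕ} (hb : b ≤ c)
    (hb' : b' ≤ c) {i : Fin m} (h : b' ≤ Function.update b i (b i + 1)) :
    rhoTuple X b' ≤ rhoTuple X b + 1 := by
  rcases (hb i).lt_or_eq with hi | hi
  · exact (rhoTuple_mono X h (update_le_iff.2 ⟨hi, fun j _ => hb j⟩)).trans
      (rhoTuple_update_succ_le X hb hi)
  -- The `i`-th chain is already full, so in fact `b' ≤ b`.
  · refine (rhoTuple_mono X (fun j => ?_) hb).trans (Nat.le_succ _)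
    rcases eq_or_ne j i with rfl | hj
    · rw [hi]
      exact hb' j
    · simpa [hj] using h j

/-- If one more step in the `i`-th chain does not increase the rank, no number of steps does. -/
theorem rhoTuple_update_eq [Infinite k] (X : Gr k V c) {b : Fin m → ℕ} (hb : b ≤ c)
    {i : Fin m} (hi : b i < c i)
    (h : rhoTuple X (Function.update b i (b i + 1)) = rhoTuple X b) :
    rhoTuple X (Function.update b i (c i)) = rhoTuple X b := by
  obtain ⟨v, -, hv⟩ := exists_generic X
  have hb0 : rhoTuple X b =
      finrank k (⨆ j, Submodule.span k (v j '' Finset.range (b j)) : Submodule k (Dual k V)) := by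
    rw [hv _ fun i => Finset.range_subset_range.2 (hb i)]
    simp
  have hmem : ∀ p < c i, v i p ∈ ⨆ j, Submodule.span k (v j '' Finset.range (b j)) := by
    intro p hp
    by_cases hpb : p < b i
    · exact Submodule.mem_iSup_of_mem i (Submodule.subset_span ⟨p, by simpa using hpb, rfl⟩)
    -- Adding `v i p` in place of the next vector `v i (b i)` gives the same cardinalities, hence
    -- the same rank; by `h` the span does not grow and contains `v i p`.
    let T : Fin m → Finset ℕ :=
      Function.update (fun j => Finset.range (b j)) i (insert p (Finset.range (b i)))
    have hT : ∀ j, T j ⊆ Finset.range (c j) := by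
      intro j
      rcases eq_or_ne j i with rfl | hj
      · simpa [T, Finset.insert_subset_iff, hp] using hb j
      · simpa [T, hj] using hb j
    have hcard : (fun j => (T j).card) = Function.update b i (b i + 1) := by
      funext j
      rcases eq_or_ne j i with rfl | hj
      · simp [T, Finset.card_insert_of_notMem, hpb]
      · simp [T, hj]
    have hle : (⨆ j, Submodule.span k (v j '' Finset.range (b j))) ≤
        ⨆ j, Submodule.span k (v j '' T j) := by
      refine iSup_mono fun j => Submodule.span_mono (Set.image_mono (Finset.coe_subset.2 ?_))
      rcases eq_or_ne j i with rfl | hj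
      · simp [T]
      · simp [T, hj]
    rw [Submodule.eq_of_le_of_finrank_eq hle (by rw [← hb0, hv T hT, hcard, h])]
    exact Submodule.mem_iSup_of_mem i (Submodule.subset_span ⟨p, by simp [T], rfl⟩)
  have hcle : Function.update b i (c i) ≤ c := update_le_iff.2 ⟨le_rfl, fun j _ => hb j⟩
  refine le_antisymm ?_ (rhoTuple_mono X (le_update_iff.2 ⟨hb i, fun j _ => le_rfl⟩) hcle)
  have hc0 : rhoTuple X (Function.update b i (c i)) =
      finrank k (⨆ j, Submodule.span k (v j '' Finset.range (Function.update b i (c i) j)) :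
        Submodule k (Dual k V)) := by
    rw [hv _ fun i => Finset.range_subset_range.2 (hcle i)]
    simp
  rw [hc0, hb0]
  refine Submodule.finrank_mono (iSup_le fun j => ?_)
  rcases eq_or_ne j i with rfl | hj
  · rw [Submodule.span_le]
    rintro _ ⟨p, hp, rfl⟩
    exact hmem p (by simpa using hp)
  · rw [Function.update_of_ne hj]
    exact le_iSup (fun i => Submodule.span k (v i '' Finset.range (b i))) j

theorem isUMatroid_rho [Infinite k] (X : Gr k V c) :
    IsUMatroid (Set.Icc 1 (∑ i, c i)) (chainLattice c) (rho X) where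
  finite_ground := Set.finite_Icc _ _
  subset_ground := by
    rintro _ ⟨b, hb, rfl⟩
    rw [← chainIdeal_self]
    exact chainIdeal_mono c hb
  empty_mem := ⟨0, fun _ => Nat.zero_le _, (chainIdeal_zero c).symm⟩
  ground_mem := ⟨c, fun _ => le_rfl, (chainIdeal_self c).symm⟩
  union_mem := by
    rintro _ ⟨b, hb, rfl⟩ _ ⟨b', hb', rfl⟩
    exact ⟨b ⊔ b', fun i => sup_le (hb i) (hb' i), (chainIdeal_sup c b b').symm⟩
  inter_mem := by
    rintro _ ⟨b, hb, rfl⟩ _ ⟨b', hb', rfl⟩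
    exact ⟨b ⊓ b', fun i => inf_le_left.trans (hb i), (chainIdeal_inf hb hb').symm⟩
  accessible := fun _ => accessible_chainLattice c
  calibration := by
    rw [← chainIdeal_zero c, rho_chainIdeal X (zero_le : 0 ≤ c), rhoTuple_zero]
  monotone := by
    rintro _ ⟨b, hb, rfl⟩ _ ⟨b', hb', rfl⟩ h
    rw [rho_chainIdeal X hb, rho_chainIdeal X hb']
    exact rhoTuple_mono X (le_of_chainIdeal_subset hb hb' h) hb'
  submodular := by
    rintro _ ⟨b, hb, rfl⟩ _ ⟨b', hb', rfl⟩
    rw [← chainIdeal_sup, ← chainIdeal_inf hb hb', rho_chainIdeal X hb, rho_chainIdeal X hb',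
      rho_chainIdeal X (sup_le hb hb' : b ⊔ b' ≤ c),
      rho_chainIdeal X (inf_le_left.trans hb : b ⊓ b' ≤ c)]
    exact rhoTuple_submodular X hb hb'
  unit_increase := by
    rintro _ ⟨b, hb, rfl⟩ e ⟨b', hb', he⟩
    obtain ⟨i, hi⟩ := chainHeights_insert_le hb hb' he.symm
    rw [he, rho_chainIdeal X hb, rho_chainIdeal X hb']
    exact rhoTuple_le_add_one X hb hb' hi

end Arrangements

/-! ### Lower semicontinuity of the rank on the product of Grassmannians -/

section Topology

open Module

variable {k : Type*} [Field k] {V : Type*} [AddCommGroup V] [Module k V] {m : ℕ}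

theorem Gr.ext_space {c : Fin m → ℕ} {X Y : Gr k V c} (h : ∀ i, X.space i = Y.space i) :
    X = Y := by
  obtain ⟨S, _⟩ := X
  obtain ⟨T, _⟩ := Y
  obtain rfl : S = T := funext h
  rfl

variable [FiniteDimensional k V]

theorem Equations.ann_solve {c : Fin m → ℕ} (Φ : Equations k V c) (i : Fin m) :
    Φ.solve.ann i = Submodule.span k (Set.range (Φ.1 i)) :=
  Subspace.dualCoannihilator_dualAnnihilator_eq

theorem Equations.mem_ann_solve {c : Fin m → ℕ} (Φ : Equations k V c) (i : Fin m)
    (p : Fin (c i)) : Φ.1 i p ∈ Φ.solve.ann i := by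
  rw [Φ.ann_solve]
  exact Submodule.subset_span ⟨p, rfl⟩

theorem Equations.solve_surjective (c : Fin m → ℕ) :
    Function.Surjective (Equations.solve : Equations k V c → Gr k V c) := by
  intro X
  choose β hli hβ using fun i => exists_basis_vectors (X.finrank_ann i)
  refine ⟨⟨β, hli⟩, Gr.ext_space fun i => ?_⟩
  rw [← Subspace.dualAnnihilator_inj]
  exact (Equations.ann_solve ⟨β, hli⟩ i).trans (hβ i)

/-- Write bases of optimal subspaces at `Φ₀` as combinations of the equations and freeze the
coefficients. The same combinations give admissible subspaces for every `Φ`, and having rank at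
least `r` is open. -/
theorem isOpen_le_rhoTuple {c b : Fin m → ℕ} (hb : b ≤ c) (r : ℕ) :
    IsOpen {X : Gr k V c | r ≤ rhoTuple X b} := by
  rw [isOpen_coinduced, isOpen_iff_forall_mem_open]
  intro Φ₀ hΦ₀
  obtain ⟨B, h1, h2, h3⟩ := exists_finrank_iSup_eq_rhoTuple Φ₀.solve hb
  choose β _ hβ using fun i => exists_basis_vectors (h2 i)
  have hM : ∀ (i : Fin m) (q : Fin (b i)), ∃ M : Fin (c i) → k,
      ∑ p, M p • Φ₀.1 i p = β i q := fun i q => by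
    rw [← Submodule.mem_span_range_iff_exists_fun, ← Φ₀.ann_solve]
    exact h1 i (hβ i ▸ Submodule.subset_span ⟨q, rfl⟩)
  choose M hM using hM
  refine ⟨_, fun Φ hΦ => ?_, ⟨_, isOpen_le_finrank_span_combination M r, rfl⟩, ?_⟩
  · refine le_trans hΦ (finrank_iSup_le_rhoTuple Φ.solve hb (fun i => ?_)
      fun i => (finrank_range_le_card _).trans (by simp))
    rw [Submodule.span_le]
    rintro _ ⟨q, rfl⟩
    exact sum_mem fun p _ => Submodule.smul_mem _ _ (Φ.mem_ann_solve i p)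
  · have hspan : ∀ i, Submodule.span k (Set.range fun q => ∑ p, M i q p • Φ₀.1 i p) = B i :=
      fun i => (congrArg (fun f => Submodule.span k (Set.range f)) (funext (hM i))).trans (hβ i)
    have hle : r ≤ finrank k (⨆ i, Submodule.span k
        (Set.range fun q => ∑ p, M i q p • Φ₀.1 i p) : Submodule k (Dual k V)) := by
      rw [iSup_congr hspan, h3]
      exact hΦ₀
    exact hle

end Topology

/-! ### Splittings of the last space -/

section Splittings

open Module

variable {k : Type*} [Field k] {V : Type*} [AddCommGroup V] [Module k V]
  {m : ℕ} {c : Fin (m + 1) → ℕ}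

theorem mem_splittings_iff {X : Gr k V c} {X' : Gr k V (splitCodim c)} :
    X' ∈ splittings X ↔ (∀ i : Fin m, X'.ann i.castSucc.castSucc = X.ann i.castSucc) ∧
      X'.ann (Fin.last m).castSucc ⊔ X'.ann (Fin.last (m + 1)) = X.ann (Fin.last m) := by
  simp only [splittings, Set.mem_ofPred_eq, Gr.ann, ← Subspace.dualAnnihilator_inf_eq,
    Subspace.dualAnnihilator_inj]

/-- The members of the original arrangement that the members of a splitting contain. -/
def splitIndex (m : ℕ) : Fin (m + 2) → Fin (m + 1) :=
  Fin.snoc (α := fun _ => Fin (m + 1)) id (Fin.last m)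

theorem splitIndex_castSucc (i : Fin (m + 1)) : splitIndex m i.castSucc = i := by
  simp [splitIndex]

theorem splitIndex_last : splitIndex m (Fin.last (m + 1)) = Fin.last m := by
  simp [splitIndex]

theorem ann_le_of_mem_splittings {X : Gr k V c} {X' : Gr k V (splitCodim c)}
    (hX' : X' ∈ splittings X) (i : Fin (m + 2)) : X'.ann i ≤ X.ann (splitIndex m i) := by
  obtain ⟨hann, hsup⟩ := mem_splittings_iff.1 hX'
  induction i using Fin.lastCases with
  | last => rw [splitIndex_last, ← hsup]; exact le_sup_right
  | cast i =>
    rw [splitIndex_castSucc]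
    induction i using Fin.lastCases with
    | last => rw [← hsup]; exact le_sup_left
    | cast i => exact (hann i).le

variable [FiniteDimensional k V]

theorem rhoTuple_le_of_mem_splittings (hc : 1 ≤ c (Fin.last m)) {X : Gr k V c}
    {X' : Gr k V (splitCodim c)} (hX' : X' ∈ splittings X) {b : Fin (m + 2) → ℕ}
    (hb : b ≤ splitCodim c) : rhoTuple X' b ≤ rhoTuple X (mergeHeights b) := by
  obtain ⟨hann, hsup⟩ := mem_splittings_iff.1 hX'
  obtain ⟨B, h1, h2, h3⟩ := exists_finrank_iSup_eq_rhoTuple X' hb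
  -- The sum of the last two subspaces is admissible for the original last space; its dimension is
  -- at most the merged height.
  let C : Fin (m + 1) → Submodule k (Dual k V) := Fin.snoc
    (α := fun _ => Submodule k (Dual k V)) (fun i => B i.castSucc.castSucc)
    (B (Fin.last m).castSucc ⊔ B (Fin.last (m + 1)))
  have hCc : ∀ i : Fin m, C i.castSucc = B i.castSucc.castSucc := fun i => by simp [C]
  have hCl : C (Fin.last m) = B (Fin.last m).castSucc ⊔ B (Fin.last (m + 1)) := by simp [C]
  rw [← h3]
  refine (Submodule.finrank_mono (iSup_le fun i => ?_)).trans
    (finrank_iSup_le_rhoTuple X (mergeHeights_le hc hb) (B := C) (fun i => ?_) fun i => ?_)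
  · induction i using Fin.lastCases with
    | last => exact (le_sup_right.trans hCl.ge).trans (le_iSup C (Fin.last m))
    | cast i =>
      induction i using Fin.lastCases with
      | last => exact (le_sup_left.trans hCl.ge).trans (le_iSup C (Fin.last m))
      | cast i => exact (hCc i).ge.trans (le_iSup C i.castSucc)
  · induction i using Fin.lastCases with
    | last =>
      rw [hCl, ← hsup]
      exact sup_le_sup (h1 _) (h1 _)
    | cast i =>
      rw [hCc, ← hann]
      exact h1 _
  · induction i using Fin.lastCases with
    | last =>
      rw [hCl, mergeHeights_last, ← h2, ← h2]
      exact Submodule.finrank_add_le_finrank_add_finrank _ _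
    | cast i =>
      rw [hCc, mergeHeights_castSucc, h2]

/-- Inside the linear space of equations taken from the annihilators of `X`, being a splitting
reduces to one lower bound on a rank, an open condition. Equality of spaces then follows by counting
dimensions. -/
theorem solve_mem_splittings {X : Gr k V c} {Φ : Equations k V (splitCodim c)}
    (h : ∀ i p, Φ.1 i p ∈ X.ann (splitIndex m i))
    (hr : c (Fin.last m) ≤ finrank k (Submodule.span k (Set.range (Φ.1 (Fin.last m).castSucc)) ⊔
      Submodule.span k (Set.range (Φ.1 (Fin.last (m + 1)))) : Submodule k (Dual k V))) :
    Φ.solve ∈ splittings X := by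
  have hle : ∀ i, Φ.solve.ann i ≤ X.ann (splitIndex m i) := fun i => by
    rw [Φ.ann_solve, Submodule.span_le]
    rintro _ ⟨p, rfl⟩
    exact h i p
  refine mem_splittings_iff.2 ⟨fun i => ?_, ?_⟩
  · refine Submodule.eq_of_le_of_finrank_eq ?_ ?_
    · simpa only [splitIndex_castSucc] using hle i.castSucc.castSucc
    · rw [Gr.finrank_ann, Gr.finrank_ann, splitCodim_castSucc_castSucc]
  · refine Submodule.eq_of_le_of_finrank_le (sup_le ?_ ?_) ?_
    · simpa only [splitIndex_castSucc] using hle (Fin.last m).castSucc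
    · simpa only [splitIndex_last] using hle (Fin.last (m + 1))
    · rw [Gr.finrank_ann, Φ.ann_solve, Φ.ann_solve]
      exact hr

theorem exists_generic_splitting [Infinite k] (hc : 1 ≤ c (Fin.last m)) (X : Gr k V c) :
    ∃ Φ : Equations k V (splitCodim c), (∀ i p, Φ.1 i p ∈ X.ann (splitIndex m i)) ∧
      c (Fin.last m) ≤ finrank k (Submodule.span k (Set.range (Φ.1 (Fin.last m).castSucc)) ⊔
        Submodule.span k (Set.range (Φ.1 (Fin.last (m + 1)))) : Submodule k (Dual k V)) ∧
      ∀ b ≤ splitCodim c, rhoTuple X (mergeHeights b) ≤ rhoTuple Φ.solve b := by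
  classical
  obtain ⟨v, hvA, hv⟩ := exists_generic X
  have hrank : ∀ j, c j ≤ finrank k (Submodule.span k (Set.range fun p : Fin (c j) => v j p)) := by
    intro j
    -- Genericity for block `j` alone: the whole annihilator shows that the maximal rank there is at
    -- least `c j`.
    let T : Fin (m + 1) → Finset ℕ := Function.update (fun _ => ∅) j (Finset.range (c j))
    have hT : ∀ i, T i ⊆ Finset.range (c i) := fun i => by
      rcases eq_or_ne i j with rfl | hi
      · simp [T]
      · simp [T, hi]
    have h1 := finrank_iSup_le_rhoTuple X (b := fun i => (T i).card)
      (fun i => by simpa using Finset.card_le_card (hT i))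
      (B := Function.update (fun _ => ⊥) j (X.ann j))
      (fun i => by
        rcases eq_or_ne i j with rfl | hi
        · simp
        · simp [hi])
      (fun i => by
        rcases eq_or_ne i j with rfl | hi
        · rw [Function.update_self, X.finrank_ann]
          simp [T]
        · rw [Function.update_of_ne hi, finrank_bot]
          exact Nat.zero_le _)
    rw [← hv T hT] at h1
    refine le_trans ?_ (h1.trans (Submodule.finrank_mono (iSup_le fun i => ?_)))
    · rw [← X.finrank_ann j]
      refine Submodule.finrank_mono (le_trans ?_ (le_iSup _ j))
      rw [Function.update_self]
    · rcases eq_or_ne i j with rfl | hi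
      · refine Submodule.span_mono ?_
        rintro _ ⟨p, hp, rfl⟩
        exact ⟨⟨p, by simpa [T] using hp⟩, rfl⟩
      · simp [T, hi]
  have hli : ∀ j, LinearIndependent k fun p : Fin (c j) => v j p := fun j =>
    linearIndependent_iff_card_le_finrank_span.2 (by rw [Fintype.card_fin]; exact hrank j)
  -- The hyperplane receives the vector of index `c (Fin.last m) - 1`, the last one when counting
  -- from 0. The shortened block uses only smaller indices.
  let u : Fin (m + 2) → ℕ → Dual k V :=
    Fin.snoc (α := fun _ => ℕ → Dual k V) v fun _ => v (Fin.last m) (c (Fin.last m) - 1)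
  have huc : ∀ i : Fin (m + 1), u i.castSucc = v i := fun i => by simp [u]
  have hul : ∀ p, u (Fin.last (m + 1)) p = v (Fin.last m) (c (Fin.last m) - 1) := fun p => by
    simp [u]
  have huA : ∀ i p, u i p ∈ X.ann (splitIndex m i) := by
    intro i p
    induction i using Fin.lastCases with
    | last => rw [hul, splitIndex_last]; exact hvA _ _
    | cast i => rw [huc, splitIndex_castSucc]; exact hvA _ _
  have huli : ∀ i, LinearIndependent k fun p : Fin (splitCodim c i) => u i p := by
    intro i
    induction i using Fin.lastCases with
    | last =>
      have : Subsingleton (Fin (splitCodim c (Fin.last (m + 1)))) := by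
        rw [splitCodim_last]; infer_instance
      simp only [hul]
      exact (hli (Fin.last m)).comp
        (fun _ => (⟨c (Fin.last m) - 1, by omega⟩ : Fin (c (Fin.last m))))
        (Function.injective_of_subsingleton _)
    | cast i =>
      simp only [huc]
      exact (hli i).comp (Fin.castLE (splitCodim_castSucc_le c i)) (Fin.castLE_injective _)
  refine ⟨⟨fun i p => u i p, huli⟩, fun i p => huA i p, ?_, fun b hb => ?_⟩
  · refine (hrank (Fin.last m)).trans (Submodule.finrank_mono ?_)
    rw [Submodule.span_le]
    rintro _ ⟨⟨p, hp⟩, rfl⟩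
    by_cases h : p < c (Fin.last m) - 1
    · refine Submodule.mem_sup_left (Submodule.subset_span ⟨⟨p, ?_⟩, ?_⟩)
      · rwa [splitCodim_castSucc_last]
      · simp [huc]
    · refine Submodule.mem_sup_right (Submodule.subset_span ⟨⟨0, ?_⟩, ?_⟩)
      · rw [splitCodim_last]; exact one_pos
      · obtain rfl : p = c (Fin.last m) - 1 := by omega
        simp [hul]
  · have hb1 : b (Fin.last m).castSucc ≤ c (Fin.last m) - 1 := by
      rw [← splitCodim_castSucc_last]; exact hb _
    have hb2 : b (Fin.last (m + 1)) ≤ 1 := (hb _).trans_eq (splitCodim_last c)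
    -- The image is `{c (Fin.last m) - 1}` or empty, as the last height is 1 or 0. It is disjoint
    -- from the initial range, so the cardinalities add up to the merged height.
    let T : Fin (m + 1) → Finset ℕ := Function.update (fun i => Finset.range (b i.castSucc))
      (Fin.last m) (Finset.range (b (Fin.last m).castSucc) ∪
        (Finset.range (b (Fin.last (m + 1)))).image fun _ => c (Fin.last m) - 1)
    have hTc : ∀ i : Fin m, T i.castSucc = Finset.range (b i.castSucc.castSucc) := fun i => by
      simp [T]
    have hTl : T (Fin.last m) = Finset.range (b (Fin.last m).castSucc) ∪
        (Finset.range (b (Fin.last (m + 1)))).image fun _ => c (Fin.last m) - 1 := by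
      simp [T]
    have hT : ∀ i, T i ⊆ Finset.range (c i) := by
      intro i p hp
      induction i using Fin.lastCases with
      | last =>
        rw [hTl] at hp
        simp only [Finset.mem_union, Finset.mem_range, Finset.mem_image] at hp ⊢
        omega
      | cast i =>
        rw [hTc] at hp
        have := hb i.castSucc.castSucc
        rw [splitCodim_castSucc_castSucc] at this
        exact Finset.range_subset_range.2 this hp
    have hcard : (fun i => (T i).card) = mergeHeights b := by
      funext i
      induction i using Fin.lastCases with
      | last =>
        rw [hTl, mergeHeights_last, Finset.card_union_of_disjoint, Finset.card_range]
        · congr 1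
          rw [Finset.card_image_of_injOn, Finset.card_range]
          intro x hx y hy _
          simp only [Finset.coe_range, Set.mem_Iio] at hx hy
          omega
        · rw [Finset.disjoint_left]
          intro p hp hp'
          simp only [Finset.mem_range, Finset.mem_image] at hp hp'
          omega
      | cast i => rw [hTc, mergeHeights_castSucc, Finset.card_range]
    rw [← hcard, ← hv T hT]
    refine le_trans (Submodule.finrank_mono (iSup_le fun i => Submodule.span_le.2 ?_))
      (finrank_iSup_le_rhoTuple (Equations.solve ⟨fun i p => u i p, huli⟩) hb
        (B := fun i => Submodule.span k (u i '' Finset.range (b i))) (fun i => ?_)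
        fun i => (finrank_span_image_le _ _).trans_eq (Finset.card_range _))
    · rintro _ ⟨p, hp, rfl⟩
      induction i using Fin.lastCases with
      | last =>
        rw [hTl] at hp
        simp only [Finset.coe_union, Set.mem_union, Finset.mem_coe, Finset.mem_image] at hp
        rcases hp with hp | ⟨q, hq, rfl⟩
        · exact Submodule.mem_iSup_of_mem (Fin.last m).castSucc
            (Submodule.subset_span ⟨p, hp, by rw [huc]⟩)
        · exact Submodule.mem_iSup_of_mem (Fin.last (m + 1))
            (Submodule.subset_span ⟨q, hq, hul q⟩)
      | cast i =>
        rw [hTc] at hp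
        exact Submodule.mem_iSup_of_mem i.castSucc.castSucc
          (Submodule.subset_span ⟨p, hp, by rw [huc]⟩)
    · rw [Submodule.span_le]
      rintro _ ⟨p, hp, rfl⟩
      exact Equations.mem_ann_solve ⟨fun i p => u i p, huli⟩ i
        ⟨p, (Finset.mem_range.1 hp).trans_le (hb i)⟩

theorem isGenerousAtomExtension_of_le [Infinite k] (hc : 2 ≤ c (Fin.last m)) {X : Gr k V c}
    {X' : Gr k V (splitCodim c)} (hX' : X' ∈ splittings X)
    (h : ∀ b ≤ splitCodim c, rhoTuple X (mergeHeights b) ≤ rhoTuple X' b) :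
    IsGenerousAtomExtension (Set.Icc 1 (∑ i, c i)) (chainLattice c) (rho X) (∑ i, c i)
      (chainLattice (splitCodim c)) (rho X') where
  isUMatroid := isUMatroid_rho X
  mem_ground := by
    have := blockStart_last_add c
    exact ⟨by omega, le_rfl⟩
  not_atom := singleton_sum_notMem_chainLattice hc
  lattice_eq := chainLattice_splitCodim (by omega)
  rank_eq := by
    rintro _ ⟨b, hb, rfl⟩
    have hc1 : 1 ≤ c (Fin.last m) := by omega
    have hb1 : b (Fin.last m).castSucc ≤ c (Fin.last m) - 1 := by
      rw [← splitCodim_castSucc_last]; exact hb _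
    have hb2 : b (Fin.last (m + 1)) ≤ 1 := (hb _).trans_eq (splitCodim_last c)
    rw [rho_chainIdeal X' hb, le_antisymm (rhoTuple_le_of_mem_splittings hc1 hX' hb) (h b hb),
      chainIdeal_splitCodim hc1 hb]
    set a : Fin (m + 1) → ℕ := fun i => b i.castSucc with ha
    have hac : a ≤ c := fun i => (hb _).trans (splitCodim_castSucc_le c i)
    have hmerge : mergeHeights b =
        Function.update a (Fin.last m) (a (Fin.last m) + b (Fin.last (m + 1))) := rfl
    rw [hmerge]
    rcases Nat.le_one_iff_eq_zero_or_eq_one.1 hb2 with h0 | h1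
    · simp only [h0, zero_ne_one, and_false, Set.ofPred_false, Set.union_empty, add_zero,
        Function.update_eq_self]
      rw [generousRank, if_pos (chainIdeal_mem hac), rho_chainIdeal X hac]
    · have hset : {e | e = ∑ i, c i ∧ b (Fin.last (m + 1)) = 1} = {∑ i, c i} := by simp [h1]
      have hlt : a (Fin.last m) < c (Fin.last m) := by simp only [ha]; omega
      have hac' : Function.update a (Fin.last m) (a (Fin.last m) + 1) ≤ c :=
        update_le_iff.2 ⟨hlt, fun i _ => hac i⟩
      have hac'' : Function.update a (Fin.last m) (c (Fin.last m)) ≤ c :=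
        update_le_iff.2 ⟨le_rfl, fun i _ => hac i⟩
      rw [hset, h1]
      -- If only the top element was missing from the last chain, the set already lies in the old
      -- lattice and the first case of the formula applies.
      by_cases htop : a (Fin.last m) + 1 = c (Fin.last m)
      · have hS : chainIdeal c a ∪ {∑ i, c i} =
            chainIdeal c (Function.update a (Fin.last m) (a (Fin.last m) + 1)) := by
          rw [chainIdeal_update_succ, add_assoc, htop, blockStart_last_add, Set.union_singleton]
        rw [hS, generousRank, if_pos (chainIdeal_mem hac'), rho_chainIdeal X hac']
      · have hdiff : (chainIdeal c a ∪ {∑ i, c i}) \ {∑ i, c i} = chainIdeal c a := by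
          rw [Set.union_singleton, Set.insert_sdiff_self_of_notMem (sum_notMem_chainIdeal hac hlt)]
        rw [generousRank, if_neg (chainIdeal_union_notMem hac (by omega)), hdiff,
          latticeSup_chainIdeal_union hc1 hac, rho_chainIdeal X hac, rho_chainIdeal X hac'']
        have hle : rhoTuple X a ≤ rhoTuple X (Function.update a (Fin.last m) (a (Fin.last m) + 1)) :=
          rhoTuple_mono X (le_update_iff.2 ⟨Nat.le_succ _, fun _ _ => le_rfl⟩) hac'
        split_ifs with heq
        · refine le_antisymm ?_ hle
          rw [heq]
          exact rhoTuple_mono X (update_le_update_iff.2 ⟨hlt, fun _ _ => le_rfl⟩) hac''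
        -- If the one step gained nothing, filling the whole chain would gain nothing either,
        -- contrary to `heq`.
        · refine le_antisymm (rhoTuple_update_succ_le X hac hlt) (lt_of_le_of_ne hle fun h' => ?_)
          exact heq (rhoTuple_update_eq X hac hlt h'.symm).symm

end Splittings

end UMat

/-! ### Genericity: nonemptiness and density -/

theorem theorem7p3 {k : Type*} [Field k] [Infinite k] {V : Type*} [AddCommGroup V] [Module k V]
    [FiniteDimensional k V] {m : ℕ} (c : Fin (m + 1) → ℕ) (hc : 2 ≤ c (Fin.last m))
    (X : UMat.Gr k V c) :
    UMat.HoldsGenerically (UMat.splittings X) fun X' =>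
      UMat.IsGenerousAtomExtension (Set.Icc 1 (∑ i, c i))
        (UMat.chainLattice c) (UMat.rho X) (∑ i, c i)
        (UMat.chainLattice (UMat.splitCodim c)) (UMat.rho X') := by
  obtain ⟨Φ₁, h1, h2, h3⟩ := UMat.exists_generic_splitting (one_le_two.trans hc) X
  let U : Set (UMat.Gr k V (UMat.splitCodim c)) :=
    ⋂ b : Set.Iic (UMat.splitCodim c),
      {X' | UMat.rhoTuple X (UMat.mergeHeights b.1) ≤ UMat.rhoTuple X' b.1}
  have hU : IsOpen U := by
    have : Finite (Set.Iic (UMat.splitCodim c)) := Set.finite_Iic _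
    exact isOpen_iInter_of_finite fun b => UMat.isOpen_le_rhoTuple b.2 _
  have hmemU : ∀ X', X' ∈ U ↔ ∀ b ≤ UMat.splitCodim c,
      UMat.rhoTuple X (UMat.mergeHeights b) ≤ UMat.rhoTuple X' b := fun X' => by
    simp [U]
  refine ⟨⟨_, UMat.solve_mem_splittings h1 h2⟩, U, hU, fun X₀ hX₀ => ?_, fun X' hX' =>
    UMat.isGenerousAtomExtension_of_le hc hX'.2 ((hmemU X').1 hX'.1)⟩
  rw [mem_closure_iff]
  intro O hO hX₀O
  obtain ⟨Φ₀, rfl⟩ := UMat.Equations.solve_surjective _ X₀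
  -- Open sets of arrangements pull back to traces of Zariski-open sets of the ambient linear space
  -- of all tuples of linear forms, where lines are available.
  obtain ⟨GO, hGO, hGO'⟩ := isOpen_coinduced.1 hO
  obtain ⟨GU, hGU, hGU'⟩ := isOpen_coinduced.1 hU
  have hO' : ∀ Φ : UMat.Equations k V (UMat.splitCodim c), Φ.1 ∈ GO ↔ Φ.solve ∈ O := fun Φ =>
    Set.ext_iff.1 hGO' Φ
  have hU' : ∀ Φ : UMat.Equations k V (UMat.splitCodim c), Φ.1 ∈ GU ↔ Φ.solve ∈ U := fun Φ =>
    Set.ext_iff.1 hGU' Φ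
  let _ := UMat.zariski k ((i : Fin (m + 2)) → Fin (UMat.splitCodim c i) → Module.Dual k V)
  obtain ⟨t, ht0, ⟨htU, htli⟩, htr⟩ := UMat.exists_line_mem_inter hGO
    ((hGU.inter (UMat.isOpen_forall_linearIndependent _)).inter
      (UMat.isOpen_le_finrank_span_sup _ (Fin.last m).castSucc (Fin.last (m + 1))
        (c (Fin.last m))))
    ((hO' Φ₀).2 hX₀O) ⟨⟨(hU' Φ₁).2 ((hmemU _).2 h3), Φ₁.2⟩, h2⟩
  let Φ : UMat.Equations k V (UMat.splitCodim c) := ⟨_, htli⟩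
  refine ⟨Φ.solve, (hO' Φ).1 ht0, (hU' Φ).1 htU, UMat.solve_mem_splittings (fun i p => ?_) htr⟩
  -- Both endpoints have their equations in the annihilators of `X`, hence so does the whole line.
  have h0 := UMat.ann_le_of_mem_splittings hX₀ i (Φ₀.mem_ann_solve i p)
  exact add_mem h0 (Submodule.smul_mem _ _ (sub_mem (h1 i p) h0))
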